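/- Let $N\ge 3$ and let $p,q\in(0,\infty)$ satisfy $\frac1p+\frac1q=\frac{N-2}{N}$. Put $q':=\frac{q}{q-1}$ and $2^*:=\frac{2N}{N-2}$. Let $D^{2,q'}(\mathbb R^N)$ be the completion of $\mathcal C_c^\infty(\mathbb R^N)$ with respect to the norm $\|u\|_{q'}:=\left(\int_{\mathbb R^N}|\Delta u|^{q'}\right)^{1/q'}$, regarded as a space of functions in $L^p(\mathbb R^N)$ by means of the Sobolev embedding $D^{2,q'}(\mathbb R^N)\hookrightarrow L^p(\mathbb R^N)$. Here $\Delta$ is the weak Laplacian, and $\|w\|_{q'}:=\infty$ if $w$ has no weak Laplacian in $L^{q'}(\mathbb R^N)$. Let $\iota(x)=\frac{x}{|x|^2}$ be the inversion in the unit sphere, and for $u:\mathbb R^N\to\mathbb R$ set $$u_\iota(x):=|\det \iota'(x)|^{1/p}\,u(\iota(x)).$$ Then $u_\iota(x)=|x|^{-2N/p}\,u\!\left(\frac{x}{|x|^2}\right)$ for all $x\neq0$, and $$\|u_\iota\|_{q'}=\|u\|_{q'}\ \text{ for every } u\in D^{2,q'}(\mathbb R^N)\quad\Longleftrightarrow\quad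 q\in\{2,2^*\}.$$ If $q\in\{2,2^*\}$, then moreover $u_\iota\in D^{2,q'}(\mathbb R^N)$ for every $u\in D^{2,q'}(\mathbb R^N)$. If $q\notin\{2,2^*\}$, then the functional $$J(u)=\frac1{q'}\int_{\mathbb R^N}|\Delta u|^{q'}-\frac1p\int_{\mathbb R^N}|u|^p,\qquad u\in D^{2,q'}(\mathbb R^N),$$ whose critical points are the weak solutions of $\Delta(|\Delta u|^{q'-2}\Delta u)=|u|^{p-2}u$ in $D^{2,q'}(\mathbb R^N)$, is not invariant under the Möbius transformation $\iota$: there is $u\in D^{2,q'}(\mathbb R^N)$ with $u_\iota\in D^{2,q'}(\mathbb R^N)$ and $J(u_\iota)\neq J(u)$. -/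

import Mathlib

open MeasureTheory Filter Topology
open scoped ContDiff ENNReal

noncomputable section

/-- The Euclidean space `ℝ^N`. -/
abbrev RN (N : ℕ) : Type := EuclideanSpace ℝ (Fin N)

/-- `φ ∈ C_c^∞(ℝ^N)`. -/
def IsTestFunction {N : ℕ} (φ : RN N → ℝ) : Prop :=
  ContDiff ℝ ∞ φ ∧ HasCompactSupport φ

/-- `g` is the weak Laplacian of `u` on `ℝ^N`. It is determined by `u` almost everywhere. -/
def IsWeakLaplacian {N : ℕ} (u g : RN N → ℝ) : Prop :=
  LocallyIntegrable u volume ∧ LocallyIntegrable g volume ∧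
    ∀ ψ : RN N → ℝ, IsTestFunction ψ →
      ∫ x, u x * Laplacian.laplacian ψ x = ∫ x, g x * ψ x

/-- The norm `‖u‖_r = (∫ |Δu|^r)^(1/r)` with the weak Laplacian `Δu`. As the weak Laplacian is unique
up to null sets, the infimum is over a single value; it is `∞` if `u` has no weak Laplacian. -/
def lapNorm {N : ℕ} (r : ℝ) (u : RN N → ℝ) : ℝ≥0∞ :=
  ⨅ (g : RN N → ℝ) (_ : IsWeakLaplacian u g), eLpNorm g (ENNReal.ofReal r) volume

/-- The space `D^{2,r}(ℝ^N)`, the completion of `C_c^∞(ℝ^N)` with respect to `‖Δ·‖_{L^r}`, realized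
as a space of functions through its embedding into `L^p(ℝ^N)`, where `p = N r / (N - 2 r)` is the
critical exponent: `u ∈ L^p` with weak Laplacian in `L^r` that is the limit of functions
`φ n ∈ C_c^∞(ℝ^N)`, in `L^p` and with respect to `‖Δ·‖_{L^r}`. -/
def D2 (N : ℕ) (p r : ℝ) : Set (RN N → ℝ) :=
  {u | MemLp u (ENNReal.ofReal p) volume ∧
    ∃ g : RN N → ℝ, IsWeakLaplacian u g ∧ MemLp g (ENNReal.ofReal r) volume ∧
      ∃ φ : ℕ → RN N → ℝ, (∀ n, IsTestFunction (φ n)) ∧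
        Tendsto (fun n => eLpNorm (fun x => φ n x - u x) (ENNReal.ofReal p) volume)
          atTop (𝓝 0) ∧
        Tendsto (fun n => eLpNorm (fun x => Laplacian.laplacian (φ n) x - g x)
          (ENNReal.ofReal r) volume) atTop (𝓝 0)}

/-- The inversion `x ↦ x / |x|^2` in the unit sphere (its value at the origin plays no role). -/
def unitInversion (N : ℕ) : RN N → RN N :=
  EuclideanGeometry.inversion (0 : RN N) 1

/-- `u_τ(x) = |det τ'(x)|^(1/p) u(τ(x))`. -/
def conformalPullback {N : ℕ} (p : ℝ) (τ : RN N → RN N) (u : RN N → ℝ) : RN N → ℝ :=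
  fun x => |(fderiv ℝ τ x).det| ^ (1 / p) * u (τ x)

/-- The functional `J(u) = (1/r) ∫ |Δu|^r - (1/p) ∫ |u|^p`, for `u ∈ D^{2,r}(ℝ^N)`. -/
def energyJ {N : ℕ} (p r : ℝ) (u : RN N → ℝ) : ℝ :=
  (1 / r) * (lapNorm r u).toReal ^ r - (1 / p) * ∫ x, |u x| ^ p

end

/-!
Write `T u = u_ι`, so `T u (x) = |x|^{-a} u(x / |x|²)` with `a = 2N/p`, and `r = q'`. The change of
variables `y = ι x` makes `T` an isometry of `L^p`, and the relation between `p` and `q` gives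
`2N/r = a + 4`, i.e. `p` is the critical exponent of `D^{2,r}`.

*Reduction to smooth functions.* Since `r < N/2`, points have zero capacity: cutting off near the
origin shows that test functions vanishing near `0` are dense in `D^{2,r}`
(`exists_approx_of_mem_D2`). On them `T u` is again a test function, so if `‖Δ T u‖_r = ‖Δ u‖_r` holds
there, completeness of `L^r` and closedness of the weak Laplacian extend it to `D^{2,r}`
(`conformalPullback_mem_D2`).

*The two good exponents.* Both rest on the Kelvin transform,
`Δ (|x|^{2-N} w(ι x)) = |x|^{-N-2} (Δ w)(ι x)` (`laplacian_kelvin`). For `q = 2^*` one has `a = N - 2`,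
so `T` is the Kelvin transform, and a change of variables concludes. For `q = 2` one has `a = N - 4`,
so `T u` is the Kelvin transform of `w = u / |x|²`, and what remains is the identity
`∫ |x|⁴ (Δ w)² = ∫ (Δ (|x|² w))²` (`integral_sq_norm_sq_mul_laplacian`), a consequence of
commutation relations between `Δ`, `|x|²` and the Euler operator `x · ∇`.

*All other exponents.* Here `r ≠ 2` and `a ∉ {0, N - 2}`. The quantity
`|s + t|^r + |s - t|^r - 2 |s|^r - 2 |t|^r` has a fixed sign, depending only on whether `r ≥ 2` or
`r ≤ 2`, and it vanishes if `s = 0` or `t = 0`. If `T` preserved `∫ |Δ u|^r`, it would therefore map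
functions whose Laplacians have disjoint supports to such functions. But take two bumps at a point
`e` of the unit sphere, one equal to `1` on the support of the other: their Laplacians have disjoint
supports, whereas both images agree with `|x|^{-a}` near `e`, whose Laplacian `a (a + 2 - N)` at `e`
is not zero (`exists_eLpNorm_laplacian_conformalPullback_ne`). As `T` is an isometry of `L^p`, the
failure for the norm is the failure for `J`.
-/

variable {N : ℕ}

/-! ### Partial derivatives and the Laplacian -/

/-- The `i`-th partial derivative, the value of `fderiv` at the `i`-th standard basis vector. -/
noncomputable def partialDeriv (i : Fin N) (f : RN N → ℝ) : RN N → ℝ :=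
  fun x => fderiv ℝ f x (EuclideanSpace.single i 1)

protected theorem ContDiffAt.partialDeriv {f : RN N → ℝ} {x : RN N} {m n : WithTop ℕ∞} (i : Fin N)
    (hf : ContDiffAt ℝ n f x) (hmn : m + 1 ≤ n) : ContDiffAt ℝ m (partialDeriv i f) x :=
  (hf.fderiv_right hmn).clm_apply contDiffAt_const

protected theorem ContDiff.partialDeriv {f : RN N → ℝ} (i : Fin N)
    (hf : ContDiff ℝ ∞ f) : ContDiff ℝ ∞ (partialDeriv i f) :=
  contDiff_iff_contDiffAt.2 fun _ => hf.contDiffAt.partialDeriv i (by simp)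

protected theorem Filter.EventuallyEq.partialDeriv {f g : RN N → ℝ} {x : RN N} (i : Fin N)
    (h : f =ᶠ[𝓝 x] g) : partialDeriv i f =ᶠ[𝓝 x] partialDeriv i g := by
  filter_upwards [h.fderiv (𝕜 := ℝ)] with y hy
  simp [partialDeriv, hy]

theorem partialDeriv_add {f g : RN N → ℝ} {x : RN N} (i : Fin N)
    (hf : DifferentiableAt ℝ f x) (hg : DifferentiableAt ℝ g x) :
    partialDeriv i (fun y => f y + g y) x = partialDeriv i f x + partialDeriv i g x := by
  simp [partialDeriv, fderiv_fun_add hf hg]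

theorem partialDeriv_sum {ι : Type*} {s : Finset ι} {f : ι → RN N → ℝ} {x : RN N} (i : Fin N)
    (hf : ∀ j ∈ s, DifferentiableAt ℝ (f j) x) :
    partialDeriv i (fun y => ∑ j ∈ s, f j y) x = ∑ j ∈ s, partialDeriv i (f j) x := by
  simp [partialDeriv, fderiv_fun_sum hf]

theorem partialDeriv_mul {f g : RN N → ℝ} {x : RN N} (i : Fin N)
    (hf : DifferentiableAt ℝ f x) (hg : DifferentiableAt ℝ g x) :
    partialDeriv i (fun y => f y * g y) x = f x * partialDeriv i g x + partialDeriv i f x * g x := by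
  simp [partialDeriv, fderiv_fun_mul hf hg, mul_comm]

theorem partialDeriv_const_mul {f : RN N → ℝ} {x : RN N} (i : Fin N) (c : ℝ)
    (hf : DifferentiableAt ℝ f x) :
    partialDeriv i (fun y => c * f y) x = c * partialDeriv i f x := by
  simp [partialDeriv, fderiv_const_mul hf]

theorem hasFDerivAt_coord (i : Fin N) (x : RN N) :
    HasFDerivAt (fun y : RN N => y i) (EuclideanSpace.proj i : RN N →L[ℝ] ℝ) x :=
  (EuclideanSpace.proj i : RN N →L[ℝ] ℝ).hasFDerivAt

theorem contDiff_coord {n : WithTop ℕ∞} (i : Fin N) : ContDiff ℝ n (fun y : RN N => y i) :=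
  (EuclideanSpace.proj i : RN N →L[ℝ] ℝ).contDiff

theorem partialDeriv_coord (i j : Fin N) :
    partialDeriv i (fun y : RN N => y j) = fun _ => if i = j then 1 else 0 := by
  ext x
  simp [partialDeriv, (hasFDerivAt_coord j x).fderiv, eq_comm]

theorem laplacian_eq_sum_partialDeriv {f : RN N → ℝ} {x : RN N} (hf : ContDiffAt ℝ 2 f x) :
    Laplacian.laplacian f x = ∑ i, partialDeriv i (partialDeriv i f) x := by
  rw [congrFun (InnerProductSpace.laplacian_eq_iteratedFDeriv_orthonormalBasis f
    (EuclideanSpace.basisFun (Fin N) ℝ)) x]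
  have hd : DifferentiableAt ℝ (fderiv ℝ f) x :=
    (hf.fderiv_right (m := 1) (by norm_num)).differentiableAt (by norm_num)
  refine Finset.sum_congr rfl fun i _ => ?_
  unfold partialDeriv
  rw [iteratedFDeriv_two_apply, fderiv_clm_apply hd (by fun_prop)]
  simp

theorem partialDeriv_comm {f : RN N → ℝ} (hf : ContDiff ℝ ∞ f) (i j : Fin N) :
    partialDeriv i (partialDeriv j f) = partialDeriv j (partialDeriv i f) := by
  ext x
  have hd : DifferentiableAt ℝ (fderiv ℝ f) x :=
    ((hf.fderiv_right (m := 1) (by norm_cast)).differentiable (by norm_num)).differentiableAt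
  have hs : IsSymmSndFDerivAt ℝ f x :=
    (hf.contDiffAt).isSymmSndFDerivAt (by
      rw [minSmoothness_of_isRCLikeNormedField]
      exact WithTop.coe_le_coe.2 le_top)
  unfold partialDeriv
  rw [fderiv_clm_apply hd (by fun_prop), fderiv_clm_apply hd (by fun_prop)]
  simpa using hs _ _

theorem laplacian_mul {f g : RN N → ℝ} {x : RN N} (hf : ContDiffAt ℝ 2 f x)
    (hg : ContDiffAt ℝ 2 g x) :
    Laplacian.laplacian (fun y => f y * g y) x = f x * Laplacian.laplacian g x +
      2 * ∑ i, partialDeriv i f x * partialDeriv i g x + Laplacian.laplacian f x * g x := by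
  rw [laplacian_eq_sum_partialDeriv hf, laplacian_eq_sum_partialDeriv hg,
    laplacian_eq_sum_partialDeriv (hf.mul hg), Finset.mul_sum, Finset.mul_sum, Finset.sum_mul,
    ← Finset.sum_add_distrib, ← Finset.sum_add_distrib]
  refine Finset.sum_congr rfl fun i _ => ?_
  have h1 : partialDeriv i (fun y => f y * g y) =ᶠ[𝓝 x]
      fun y => f y * partialDeriv i g y + partialDeriv i f y * g y := by
    filter_upwards [hf.eventually (by simp), hg.eventually (by simp)] with y hy hy'
    exact partialDeriv_mul i (hy.differentiableAt (by norm_num)) (hy'.differentiableAt (by norm_num))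
  have df := hf.differentiableAt (by norm_num)
  have dg := hg.differentiableAt (by norm_num)
  have df' := (hf.partialDeriv (m := 1) i (by norm_num)).differentiableAt (by norm_num)
  have dg' := (hg.partialDeriv (m := 1) i (by norm_num)).differentiableAt (by norm_num)
  rw [(h1.partialDeriv i).eq_of_nhds, partialDeriv_add i (df.fun_mul dg') (df'.fun_mul dg),
    partialDeriv_mul i df dg', partialDeriv_mul i df' dg]
  ring

theorem laplacian_coord_mul {f : RN N → ℝ} {x : RN N} (j : Fin N) (hf : ContDiffAt ℝ 2 f x) :
    Laplacian.laplacian (fun y : RN N => y j * f y) x =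
      x j * Laplacian.laplacian f x + 2 * partialDeriv j f x := by
  rw [laplacian_mul (contDiff_coord j).contDiffAt hf,
    laplacian_eq_sum_partialDeriv (contDiff_coord j).contDiffAt]
  simp_rw [partialDeriv_coord]
  simp [partialDeriv]

/-! ### Powers of the norm -/

theorem contDiffAt_norm_rpow {n : WithTop ℕ∞} (c : ℝ) {x : RN N} (hx : x ≠ 0) :
    ContDiffAt ℝ n (fun y : RN N => ‖y‖ ^ c) x :=
  (contDiffAt_norm ℝ hx).rpow_const_of_ne (norm_ne_zero_iff.2 hx)

theorem partialDeriv_norm_rpow (c : ℝ) {x : RN N} (hx : x ≠ 0) (i : Fin N) :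
    partialDeriv i (fun y : RN N => ‖y‖ ^ c) x = c * (‖x‖ ^ (c - 2) * x i) := by
  have hpos : 0 < ‖x‖ := norm_pos_iff.2 hx
  have h : HasFDerivAt (fun y : RN N => (‖y‖ ^ 2) ^ (c / 2)) _ x :=
    (hasStrictFDerivAt_norm_sq x).hasFDerivAt.rpow_const (p := c / 2)
      (Or.inl (by positivity))
  have h2 : (fun y : RN N => (‖y‖ ^ 2) ^ (c / 2)) = fun y => ‖y‖ ^ c := by
    ext y
    rw [← Real.rpow_natCast, ← Real.rpow_mul (norm_nonneg _)]
    congr 1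
    push_cast; ring
  rw [h2] at h
  have h3 : (‖x‖ ^ 2) ^ (c / 2 - 1) = ‖x‖ ^ (c - 2) := by
    rw [← Real.rpow_natCast, ← Real.rpow_mul hpos.le]
    congr 1
    push_cast; ring
  simp [partialDeriv, h.fderiv, h3, EuclideanSpace.inner_single_right]
  ring

theorem laplacian_norm_rpow (c : ℝ) {x : RN N} (hx : x ≠ 0) :
    Laplacian.laplacian (fun y : RN N => ‖y‖ ^ c) x = c * (c + N - 2) * ‖x‖ ^ (c - 2) := by
  have hpos : 0 < ‖x‖ := norm_pos_iff.2 hx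
  rw [laplacian_eq_sum_partialDeriv (contDiffAt_norm_rpow c hx)]
  have h1 (i : Fin N) : partialDeriv i (partialDeriv i (fun y : RN N => ‖y‖ ^ c)) x
      = c * (‖x‖ ^ (c - 2) + (c - 2) * (‖x‖ ^ (c - 4) * (x i) ^ 2)) := by
    have h2 : partialDeriv i (fun y : RN N => ‖y‖ ^ c) =ᶠ[𝓝 x]
        fun y => c * (‖y‖ ^ (c - 2) * y i) := by
      filter_upwards [isOpen_ne.mem_nhds hx] with y hy
      exact partialDeriv_norm_rpow c hy i
    have hd := (contDiffAt_norm_rpow (n := 1) (c - 2) hx).differentiableAt (by norm_num)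
    have hd' := (hasFDerivAt_coord i x).differentiableAt
    rw [(h2.partialDeriv i).eq_of_nhds, partialDeriv_const_mul i c (hd.fun_mul hd'),
      partialDeriv_mul i hd hd', partialDeriv_norm_rpow _ hx, partialDeriv_coord]
    simp only [if_true, show c - 2 - 2 = c - 4 by ring]
    ring
  simp_rw [h1, ← Finset.mul_sum, Finset.sum_add_distrib, ← Finset.mul_sum]
  rw [← EuclideanSpace.real_norm_sq_eq]
  have h4 : ‖x‖ ^ (c - 4) * ‖x‖ ^ 2 = ‖x‖ ^ (c - 2) := by
    rw [← Real.rpow_natCast, ← Real.rpow_add hpos]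
    congr 1
    push_cast; ring
  rw [h4]
  simp
  ring

/-! ### The chain rule and the Kelvin transform -/

theorem partialDeriv_comp {u : RN N → ℝ} {F : RN N → RN N} {x : RN N} (i : Fin N)
    (hu : DifferentiableAt ℝ u (F x)) (hF : DifferentiableAt ℝ F x) :
    partialDeriv i (fun y => u (F y)) x =
      ∑ j, partialDeriv j u (F x) * partialDeriv i (fun y => F y j) x := by
  have hc (j : Fin N) : partialDeriv i (fun y => F y j) x =
      (fderiv ℝ F x (EuclideanSpace.single i 1)) j := by
    have := ((hasFDerivAt_coord j (F x)).comp x hF.hasFDerivAt).fderiv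
    simp only [Function.comp_def] at this
    simp [partialDeriv, this]
  simp_rw [hc]
  have hcomp : fderiv ℝ (fun y => u (F y)) x = (fderiv ℝ u (F x)).comp (fderiv ℝ F x) :=
    fderiv_comp x hu hF
  simp only [partialDeriv, hcomp, ContinuousLinearMap.comp_apply]
  conv_lhs => rw [← (EuclideanSpace.basisFun (Fin N) ℝ).sum_repr
    (fderiv ℝ F x (EuclideanSpace.single i 1))]
  simp [mul_comm]

theorem laplacian_comp {u : RN N → ℝ} {F : RN N → RN N} {x : RN N}
    (hu : ContDiffAt ℝ 2 u (F x)) (hF : ContDiffAt ℝ 2 F x) :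
    Laplacian.laplacian (fun y => u (F y)) x =
      ∑ j, ∑ k, partialDeriv k (partialDeriv j u) (F x) *
        (∑ i, partialDeriv i (fun y => F y k) x * partialDeriv i (fun y => F y j) x) +
      ∑ j, partialDeriv j u (F x) * Laplacian.laplacian (fun y => F y j) x := by
  have hFc (j : Fin N) : ContDiffAt ℝ 2 (fun y => F y j) x :=
    (contDiff_coord j).contDiffAt.comp x hF
  have hcomp : ContDiffAt ℝ 2 (fun y => u (F y)) x := hu.comp x hF
  rw [laplacian_eq_sum_partialDeriv hcomp]
  simp_rw [fun j => laplacian_eq_sum_partialDeriv (hFc j)]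
  have h1 (i : Fin N) : partialDeriv i (partialDeriv i (fun y => u (F y))) x =
      ∑ j, (∑ k, partialDeriv k (partialDeriv j u) (F x) *
        (partialDeriv i (fun y => F y k) x * partialDeriv i (fun y => F y j) x) +
        partialDeriv j u (F x) * partialDeriv i (partialDeriv i (fun y => F y j)) x) := by
    have h2 : partialDeriv i (fun y => u (F y)) =ᶠ[𝓝 x]
        fun y => ∑ j, partialDeriv j u (F y) * partialDeriv i (fun y => F y j) y := by
      filter_upwards [hF.continuousAt.eventually (hu.eventually (by simp)),
        hF.eventually (by simp)] with y hy hy'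
      exact partialDeriv_comp i (hy.differentiableAt (by norm_num))
        (hy'.differentiableAt (by norm_num))
    have du (j : Fin N) : DifferentiableAt ℝ (partialDeriv j u) (F x) :=
      (hu.partialDeriv (m := 1) j (by norm_num)).differentiableAt (by norm_num)
    have dF := hF.differentiableAt (by norm_num)
    have du' (j : Fin N) : DifferentiableAt ℝ (fun y => partialDeriv j u (F y)) x :=
      (du j).comp x dF
    have dF' (j : Fin N) : DifferentiableAt ℝ (partialDeriv i (fun y => F y j)) x :=
      ((hFc j).partialDeriv (m := 1) i (by norm_num)).differentiableAt (by norm_num)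
    rw [(h2.partialDeriv i).eq_of_nhds,
      partialDeriv_sum i (fun j _ => (du' j).fun_mul (dF' j))]
    refine Finset.sum_congr rfl fun j _ => ?_
    rw [partialDeriv_mul i (du' j) (dF' j), partialDeriv_comp i (du j) dF, Finset.sum_mul,
      add_comm]
    simp_rw [mul_assoc]
  simp_rw [h1, Finset.mul_sum]
  rw [Finset.sum_comm, ← Finset.sum_add_distrib]
  refine Finset.sum_congr rfl fun j _ => ?_
  rw [Finset.sum_add_distrib, Finset.sum_comm]

theorem unitInversion_eq (x : RN N) : unitInversion N x = (‖x‖ ^ 2)⁻¹ • x := by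
  simp [unitInversion, EuclideanGeometry.inversion]

theorem unitInversion_coord {x : RN N} (j : Fin N) :
    unitInversion N x j = x j * ‖x‖ ^ (-2 : ℝ) := by
  rw [unitInversion_eq, Real.rpow_neg (norm_nonneg _)]
  simp [mul_comm]

theorem unitInversion_ne_zero {x : RN N} (hx : x ≠ 0) : unitInversion N x ≠ 0 := by
  rw [unitInversion_eq]
  simpa using hx

theorem norm_unitInversion (x : RN N) : ‖unitInversion N x‖ = ‖x‖⁻¹ := by
  rcases eq_or_ne x 0 with rfl | hx
  · simp [unitInversion_eq]
  have : ‖x‖ ≠ 0 := norm_ne_zero_iff.2 hx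
  rw [unitInversion_eq, norm_smul, norm_inv, norm_pow, norm_norm]
  field_simp

theorem unitInversion_unitInversion (x : RN N) :
    unitInversion N (unitInversion N x) = x :=
  EuclideanGeometry.inversion_inversion 0 one_ne_zero x

theorem contDiffAt_unitInversion {n : WithTop ℕ∞} {x : RN N} (hx : x ≠ 0) :
    ContDiffAt ℝ n (unitInversion N) x := by
  rw [funext unitInversion_eq]
  exact ((contDiff_norm_sq ℝ).contDiffAt.inv (by simpa using hx)).smul contDiffAt_id

theorem partialDeriv_unitInversion {x : RN N} (hx : x ≠ 0) (i j : Fin N) :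
    partialDeriv i (fun y => unitInversion N y j) x =
      (if i = j then 1 else 0) * ‖x‖ ^ (-2 : ℝ) - 2 * ‖x‖ ^ (-4 : ℝ) * (x i * x j) := by
  simp_rw [unitInversion_coord]
  rw [partialDeriv_mul i (hasFDerivAt_coord j x).differentiableAt
    ((contDiffAt_norm_rpow (n := 1) _ hx).differentiableAt (by norm_num)),
    partialDeriv_norm_rpow _ hx, partialDeriv_coord, show (-2 : ℝ) - 2 = -4 by norm_num]
  ring

/-- The inversion is conformal: its derivative is `|x|⁻²` times an orthogonal matrix. -/
theorem sum_partialDeriv_unitInversion {x : RN N} (hx : x ≠ 0) (j k : Fin N) :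
    ∑ i, partialDeriv i (fun y => unitInversion N y k) x *
      partialDeriv i (fun y => unitInversion N y j) x =
      if k = j then ‖x‖ ^ (-4 : ℝ) else 0 := by
  simp_rw [partialDeriv_unitInversion hx]
  have hpos : 0 < ‖x‖ := norm_pos_iff.2 hx
  have h1 : ‖x‖ ^ (-2 : ℝ) = (‖x‖ ^ 2)⁻¹ := by
    rw [Real.rpow_neg hpos.le]; norm_cast
  have h2 : ‖x‖ ^ (-4 : ℝ) = (‖x‖ ^ 4)⁻¹ := by
    rw [Real.rpow_neg hpos.le]; norm_cast
  have h3 (i : Fin N) : ((if i = k then 1 else 0) * ‖x‖ ^ (-2 : ℝ) -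
      2 * ‖x‖ ^ (-4 : ℝ) * (x i * x k)) *
      ((if i = j then 1 else 0) * ‖x‖ ^ (-2 : ℝ) - 2 * ‖x‖ ^ (-4 : ℝ) * (x i * x j)) =
      (if i = k then (if k = j then ‖x‖ ^ (-2 : ℝ) * ‖x‖ ^ (-2 : ℝ) else 0) else 0)
      - (if i = k then 2 * ‖x‖ ^ (-2 : ℝ) * ‖x‖ ^ (-4 : ℝ) * (x k * x j) else 0)
      - (if i = j then 2 * ‖x‖ ^ (-2 : ℝ) * ‖x‖ ^ (-4 : ℝ) * (x k * x j) else 0)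
      + 4 * ‖x‖ ^ (-4 : ℝ) * ‖x‖ ^ (-4 : ℝ) * (x k * x j) * (x i) ^ 2 := by
    split_ifs <;> subst_vars <;> first | ring1 | exact absurd rfl ‹_›
  simp_rw [h3, Finset.sum_add_distrib, Finset.sum_sub_distrib, ← Finset.mul_sum,
    ← EuclideanSpace.real_norm_sq_eq]
  simp only [Finset.sum_ite_eq', Finset.mem_univ, if_true, h1, h2]
  split_ifs <;> field_simp <;> ring

theorem laplacian_unitInversion {x : RN N} (hx : x ≠ 0) (j : Fin N) :
    Laplacian.laplacian (fun y => unitInversion N y j) x =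
      -2 * (N - 2) * ‖x‖ ^ (-4 : ℝ) * x j := by
  simp_rw [unitInversion_coord]
  rw [laplacian_coord_mul j (contDiffAt_norm_rpow _ hx), laplacian_norm_rpow _ hx,
    partialDeriv_norm_rpow _ hx, show (-2 : ℝ) - 2 = -4 by norm_num]
  ring

/-- The Kelvin transform intertwines the Laplacian with a multiple of itself. -/
theorem laplacian_kelvin {u : RN N → ℝ} {x : RN N} (hx : x ≠ 0)
    (hu : ContDiffAt ℝ 2 u (unitInversion N x)) :
    Laplacian.laplacian (fun y => ‖y‖ ^ (2 - N : ℝ) * u (unitInversion N y)) x =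
      ‖x‖ ^ (-N - 2 : ℝ) * Laplacian.laplacian u (unitInversion N x) := by
  have hpos : 0 < ‖x‖ := norm_pos_iff.2 hx
  have hI := contDiffAt_unitInversion (n := 2) hx
  have hcomp : ContDiffAt ℝ 2 (fun y => u (unitInversion N y)) x := hu.comp x hI
  rw [laplacian_mul (contDiffAt_norm_rpow _ hx) hcomp, laplacian_norm_rpow _ hx,
    laplacian_comp hu hI, laplacian_eq_sum_partialDeriv hu]
  simp_rw [sum_partialDeriv_unitInversion hx, laplacian_unitInversion hx,
    partialDeriv_comp _ (hu.differentiableAt (by norm_num)) (hI.differentiableAt (by norm_num)),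
    partialDeriv_norm_rpow _ hx]
  have h1 : ∑ i, (2 - N : ℝ) * (‖x‖ ^ (2 - N - 2 : ℝ) * x i) *
      ∑ j, partialDeriv j u (unitInversion N x) * partialDeriv i (fun y => unitInversion N y j) x
      = -(2 - N : ℝ) * ‖x‖ ^ (2 - N - 2 : ℝ) * ‖x‖ ^ (-2 : ℝ) *
        ∑ j, partialDeriv j u (unitInversion N x) * x j := by
    have h2 (j : Fin N) : ∑ i, x i * partialDeriv i (fun y => unitInversion N y j) x =
        - ‖x‖ ^ (-2 : ℝ) * x j := by
      have h3 (i : Fin N) : x i * partialDeriv i (fun y => unitInversion N y j) x =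
          (if i = j then x j * ‖x‖ ^ (-2 : ℝ) else 0) - 2 * ‖x‖ ^ (-4 : ℝ) * x j * (x i) ^ 2 := by
        rw [partialDeriv_unitInversion hx]
        split_ifs <;> subst_vars <;> ring
      simp_rw [h3, Finset.sum_sub_distrib, ← Finset.mul_sum, ← EuclideanSpace.real_norm_sq_eq]
      have : ‖x‖ ^ (-4 : ℝ) * ‖x‖ ^ 2 = ‖x‖ ^ (-2 : ℝ) := by
        rw [← Real.rpow_natCast, ← Real.rpow_add hpos]; norm_num
      simp only [Finset.sum_ite_eq', Finset.mem_univ, if_true]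
      linear_combination (-2 * x j) * this
    simp_rw [Finset.mul_sum]
    rw [Finset.sum_comm]
    refine Finset.sum_congr rfl fun j _ => ?_
    have := h2 j
    calc _ = (2 - N : ℝ) * ‖x‖ ^ (2 - N - 2 : ℝ) * partialDeriv j u (unitInversion N x) *
          ∑ i, x i * partialDeriv i (fun y => unitInversion N y j) x := by
          rw [Finset.mul_sum]
          exact Finset.sum_congr rfl fun i _ => by ring
      _ = _ := by rw [this]; ring
  rw [h1]
  have e1 : ‖x‖ ^ (2 - N : ℝ) * ‖x‖ ^ (-4 : ℝ) = ‖x‖ ^ (-N - 2 : ℝ) := by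
    rw [← Real.rpow_add hpos]; ring_nf
  have e2 : ‖x‖ ^ (2 - N - 2 : ℝ) * ‖x‖ ^ (-2 : ℝ) = ‖x‖ ^ (-N - 2 : ℝ) := by
    rw [← Real.rpow_add hpos]; ring_nf
  have h4 : ∑ j, ∑ k, partialDeriv k (partialDeriv j u) (unitInversion N x) *
      (if k = j then ‖x‖ ^ (-4 : ℝ) else 0) =
      ‖x‖ ^ (-4 : ℝ) * ∑ j, partialDeriv j (partialDeriv j u) (unitInversion N x) := by
    rw [Finset.mul_sum]
    exact Finset.sum_congr rfl fun j _ => by simp [-Real.rpow_neg_ofNat, mul_comm]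
  have h5 : ∑ j, partialDeriv j u (unitInversion N x) *
      (-2 * (N - 2) * ‖x‖ ^ (-4 : ℝ) * x j) = -2 * (N - 2) * ‖x‖ ^ (-4 : ℝ) *
        ∑ j, partialDeriv j u (unitInversion N x) * x j := by
    rw [Finset.mul_sum]
    exact Finset.sum_congr rfl fun i _ => by ring
  rw [h4, h5]
  set A := ∑ j, partialDeriv j u (unitInversion N x) * x j
  set B := ∑ j, partialDeriv j (partialDeriv j u) (unitInversion N x)
  linear_combination (B - 2 * (N - 2) * A) * e1 + (2 * (N - 2) * A) * e2

/-! ### The conformal pullback under the inversion -/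

theorem abs_det_fderiv_unitInversion {x : RN N} (hx : x ≠ 0) :
    |(fderiv ℝ (unitInversion N) x).det| = ‖x‖ ^ (-(2 * N : ℝ)) := by
  have h := (EuclideanGeometry.hasFDerivAt_inversion (R := 1) hx).fderiv
  have hrefl : |LinearMap.det ((ℝ ∙ (x - 0))ᗮ.reflection.toLinearEquiv : RN N →ₗ[ℝ] RN N)| = 1 := by
    have := Submodule.det_reflection (𝕜 := ℝ) (K := (ℝ ∙ (x - 0))ᗮ)
    rw [show LinearMap.det ((ℝ ∙ (x - 0))ᗮ.reflection.toLinearEquiv : RN N →ₗ[ℝ] RN N) = _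
      from this]
    simp [abs_pow]
  rw [unitInversion, h, ContinuousLinearMap.det]
  have h2 : (((1 / dist x 0) ^ 2 • ((ℝ ∙ (x - 0))ᗮ.reflection : RN N →L[ℝ] RN N) :
      RN N →L[ℝ] RN N) : RN N →ₗ[ℝ] RN N) = (1 / dist x 0) ^ 2 •
      ((ℝ ∙ (x - 0))ᗮ.reflection.toLinearEquiv : RN N →ₗ[ℝ] RN N) := rfl
  rw [h2, LinearMap.det_smul, abs_mul, hrefl, dist_zero_right, Real.rpow_neg (norm_nonneg _),
    Real.rpow_mul (norm_nonneg _)]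
  simp

theorem conformalPullback_unitInversion (s : ℝ) (u : RN N → ℝ) {x : RN N} (hx : x ≠ 0) :
    conformalPullback s (unitInversion N) u x =
      ‖x‖ ^ (-(2 * (N : ℝ) / s)) * u (unitInversion N x) := by
  rw [conformalPullback, abs_det_fderiv_unitInversion hx, ← Real.rpow_mul (norm_nonneg _)]
  congr 2
  ring

theorem ae_ne_zero (hN : 0 < N) : ∀ᵐ x : RN N, x ≠ 0 := by
  have : Nonempty (Fin N) := ⟨⟨0, hN⟩⟩
  exact Measure.ae_ne volume 0

theorem lintegral_comp_unitInversion (hN : 0 < N) (g : RN N → ℝ≥0∞) :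
    ∫⁻ x, ENNReal.ofReal |(fderiv ℝ (unitInversion N) x).det| * g (unitInversion N x) =
      ∫⁻ x, g x := by
  have : Nonempty (Fin N) := ⟨⟨0, hN⟩⟩
  have himg : unitInversion N '' {0}ᶜ = {0}ᶜ := by
    ext x
    constructor
    · rintro ⟨y, hy, rfl⟩
      exact unitInversion_ne_zero hy
    · intro hx
      exact ⟨unitInversion N x, unitInversion_ne_zero hx, unitInversion_unitInversion x⟩
  have hinj : Function.Injective (unitInversion N) :=
    Function.LeftInverse.injective unitInversion_unitInversion
  have hd : ∀ x ∈ ({0}ᶜ : Set (RN N)), HasFDerivWithinAt (unitInversion N)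
      (fderiv ℝ (unitInversion N) x) {0}ᶜ x := fun x hx =>
    ((contDiffAt_unitInversion (n := 1) hx).differentiableAt
      (by norm_num)).hasFDerivAt.hasFDerivWithinAt
  have h := lintegral_image_eq_lintegral_abs_det_fderiv_mul volume
    (measurableSet_singleton (0 : RN N)).compl hd hinj.injOn g
  rw [himg] at h
  simpa [restrict_compl_singleton] using h.symm

/-- The weight `|det ι'|^{1/s}` makes the pullback an isometry of `L^s`. -/
theorem eLpNorm_conformalPullback (hN : 0 < N) {s : ℝ} (hs : 0 < s) (f : RN N → ℝ) :
    eLpNorm (conformalPullback s (unitInversion N) f) (ENNReal.ofReal s) volume =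
      eLpNorm f (ENNReal.ofReal s) volume := by
  rw [eLpNorm_eq_lintegral_rpow_enorm_toReal (by simpa using hs) (by simp),
    eLpNorm_eq_lintegral_rpow_enorm_toReal (by simpa using hs) (by simp),
    ENNReal.toReal_ofReal hs.le, ← lintegral_comp_unitInversion hN (fun x => ‖f x‖ₑ ^ s)]
  congr 2
  ext x
  rw [conformalPullback, enorm_mul, ENNReal.mul_rpow_of_nonneg _ _ hs.le]
  congr 1
  rw [Real.enorm_eq_ofReal (by positivity), ENNReal.ofReal_rpow_of_nonneg (by positivity) hs.le,
    ← Real.rpow_mul (abs_nonneg _), one_div_mul_cancel hs.ne', Real.rpow_one]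

theorem quasiMeasurePreserving_unitInversion (hN : 0 < N) :
    Measure.QuasiMeasurePreserving (unitInversion N) := by
  refine ⟨?_, ?_⟩
  · rw [funext unitInversion_eq]
    fun_prop
  · have hm : Measurable (unitInversion N) := by
      rw [funext unitInversion_eq]
      fun_prop
    refine Measure.AbsolutelyContinuous.mk fun A hA hA0 => ?_
    rw [Measure.map_apply hm hA]
    have h0 : unitInversion N ⁻¹' A ⊆ unitInversion N '' (A \ {0}) ∪ {0} := by
      intro x hx
      by_cases h : x = 0
      · exact Or.inr h
      · exact Or.inl ⟨unitInversion N x, ⟨hx, unitInversion_ne_zero h⟩,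
          unitInversion_unitInversion x⟩
    have : Nonempty (Fin N) := ⟨⟨0, hN⟩⟩
    refine measure_mono_null h0 (measure_union_null ?_ (by simp))
    refine addHaar_image_eq_zero_of_differentiableOn_of_addHaar_eq_zero volume ?_
      (measure_mono_null Set.sdiff_subset hA0)
    exact fun x hx => ((contDiffAt_unitInversion (n := 1) hx.2).differentiableAt
      (by norm_num)).differentiableWithinAt

theorem conformalPullback_sub (s : ℝ) (τ : RN N → RN N) (u v : RN N → ℝ) (x : RN N) :
    conformalPullback s τ (fun y => u y - v y) x =
      conformalPullback s τ u x - conformalPullback s τ v x := by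
  simp [conformalPullback, mul_sub]

theorem conformalPullback_add (s : ℝ) (τ : RN N → RN N) (u v : RN N → ℝ) (x : RN N) :
    conformalPullback s τ (fun y => u y + v y) x =
      conformalPullback s τ u x + conformalPullback s τ v x := by
  simp [conformalPullback, mul_add]

theorem MeasureTheory.MemLp.conformalPullback (hN : 0 < N) {s : ℝ} (hs : 0 < s) {u : RN N → ℝ}
    (hu : MemLp u (ENNReal.ofReal s) volume) :
    MemLp (conformalPullback s (unitInversion N) u) (ENNReal.ofReal s) volume := by
  refine ⟨?_, by rw [eLpNorm_conformalPullback hN hs]; exact hu.2⟩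
  have h : AEStronglyMeasurable
      (fun x => ‖x‖ ^ (-(2 * (N : ℝ) / s)) * u (unitInversion N x)) volume :=
    (measurable_norm.pow_const _).aestronglyMeasurable.mul
      (hu.1.comp_quasiMeasurePreserving (quasiMeasurePreserving_unitInversion hN))
  refine h.congr ?_
  filter_upwards [ae_ne_zero hN] with x hx
  exact (conformalPullback_unitInversion s u hx).symm

/-- A test function that vanishes near the origin is mapped to such a test function. -/
theorem isTestFunction_conformalPullback (s : ℝ) {u : RN N → ℝ} (hu : IsTestFunction u)
    (h0 : u =ᶠ[𝓝 0] 0) :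
    IsTestFunction (conformalPullback s (unitInversion N) u) ∧
      conformalPullback s (unitInversion N) u =ᶠ[𝓝 0] 0 := by
  obtain ⟨R, hR, hRu⟩ : ∃ R > 0, ∀ x, R ≤ ‖x‖ → u x = 0 := by
    obtain ⟨R, hR⟩ := hu.2.isCompact.isBounded.subset_ball (0 : RN N)
    refine ⟨max R 1, by positivity, fun x hx => ?_⟩
    by_contra h
    have := hR (subset_tsupport u h)
    rw [mem_ball_zero_iff] at this
    exact absurd hx (not_le.2 (this.trans_le (le_max_left _ _)))
  have hz : conformalPullback s (unitInversion N) u =ᶠ[𝓝 0] 0 := by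
    filter_upwards [Metric.ball_mem_nhds (0 : RN N) (inv_pos.2 hR)] with x hx
    rw [mem_ball_zero_iff] at hx
    have : u (unitInversion N x) = 0 := by
      rcases eq_or_ne x 0 with rfl | hx0
      · simpa [unitInversion_eq] using h0.eq_of_nhds
      · apply hRu
        rw [norm_unitInversion]
        exact (le_inv_comm₀ hR (norm_pos_iff.2 hx0)).2 hx.le
    simp [conformalPullback, this]
  refine ⟨⟨?_, ?_⟩, hz⟩
  · rw [contDiff_iff_contDiffAt]
    intro x
    rcases eq_or_ne x 0 with rfl | hx0
    · exact contDiffAt_const.congr_of_eventuallyEq hz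
    · have : conformalPullback s (unitInversion N) u =ᶠ[𝓝 x]
          fun x => ‖x‖ ^ (-(2 * (N : ℝ) / s)) * u (unitInversion N x) := by
        filter_upwards [isOpen_ne.mem_nhds hx0] with y hy
        exact conformalPullback_unitInversion s u hy
      exact ((contDiffAt_norm_rpow _ hx0).mul
        (hu.1.contDiffAt.comp x (contDiffAt_unitInversion hx0))).congr_of_eventuallyEq this
  · obtain ⟨ε, hε, hεu⟩ := Metric.eventually_nhds_iff.1 h0
    refine HasCompactSupport.intro (isCompact_closedBall (0 : RN N) ε⁻¹) fun x hx => ?_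
    rw [mem_closedBall_zero_iff, not_le] at hx
    have : u (unitInversion N x) = 0 := by
      refine hεu ?_
      rw [dist_zero_right, norm_unitInversion]
      exact (inv_lt_comm₀ hε ((inv_pos.2 hε).trans hx)).1 hx
    simp [conformalPullback, this]

/-! ### Test functions -/

protected theorem ContDiff.laplacian {f : RN N → ℝ} (hf : ContDiff ℝ ∞ f) :
    ContDiff ℝ ∞ (Laplacian.laplacian f) := by
  have : Laplacian.laplacian f = fun x => ∑ i, partialDeriv i (partialDeriv i f) x :=
    funext fun x => laplacian_eq_sum_partialDeriv (hf.contDiffAt.of_le (WithTop.coe_le_coe.2 le_top))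
  rw [this]
  exact ContDiff.sum fun i _ => (hf.partialDeriv i).partialDeriv i

theorem laplacian_eq_zero_of_eventuallyEq {f : RN N → ℝ} {x : RN N} {c : ℝ}
    (h : f =ᶠ[𝓝 x] fun _ => c) : Laplacian.laplacian f x = 0 := by
  rw [(InnerProductSpace.laplacian_congr_nhds h).eq_of_nhds]
  simp

theorem Filter.EventuallyEq.laplacian_eq {f g : RN N → ℝ} {x : RN N} (h : f =ᶠ[𝓝 x] g) :
    Laplacian.laplacian f x = Laplacian.laplacian g x :=
  (InnerProductSpace.laplacian_congr_nhds h).eq_of_nhds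

namespace IsTestFunction

variable {φ ψ : RN N → ℝ}

theorem contDiffAt_two (hφ : IsTestFunction φ) (x : RN N) : ContDiffAt ℝ 2 φ x :=
  hφ.1.contDiffAt.of_le (WithTop.coe_le_coe.2 le_top)

theorem differentiableAt (hφ : IsTestFunction φ) (x : RN N) : DifferentiableAt ℝ φ x :=
  (hφ.contDiffAt_two x).differentiableAt (by norm_num)

protected theorem laplacian (hφ : IsTestFunction φ) : IsTestFunction (Laplacian.laplacian φ) := by
  refine ⟨hφ.1.laplacian, HasCompactSupport.intro hφ.2.isCompact fun x hx => ?_⟩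
  exact laplacian_eq_zero_of_eventuallyEq (notMem_tsupport_iff_eventuallyEq.1 hx)

protected theorem partialDeriv (hφ : IsTestFunction φ) (i : Fin N) : IsTestFunction (partialDeriv i φ) :=
  ⟨hφ.1.partialDeriv i, hφ.2.fderiv_apply ℝ _⟩

theorem add (hφ : IsTestFunction φ) (hψ : IsTestFunction ψ) :
    IsTestFunction (fun x => φ x + ψ x) :=
  ⟨hφ.1.add hψ.1, hφ.2.add hψ.2⟩

theorem sub (hφ : IsTestFunction φ) (hψ : IsTestFunction ψ) :
    IsTestFunction (fun x => φ x - ψ x) :=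
  ⟨hφ.1.sub hψ.1, hφ.2.sub hψ.2⟩

theorem smooth_mul {f : RN N → ℝ} (hf : ContDiff ℝ ∞ f) (hφ : IsTestFunction φ) :
    IsTestFunction (fun x => f x * φ x) :=
  ⟨hf.mul hφ.1, hφ.2.mul_left⟩

theorem sum {ι : Type*} {s : Finset ι} {φ : ι → RN N → ℝ} (hφ : ∀ i ∈ s, IsTestFunction (φ i)) :
    IsTestFunction (fun x => ∑ i ∈ s, φ i x) := by
  classical
  induction s using Finset.induction_on with
  | empty =>
    simp_rw [Finset.sum_empty]
    exact ⟨contDiff_const, HasCompactSupport.zero⟩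
  | insert i s hi ih =>
    simp_rw [Finset.sum_insert hi]
    exact (hφ i (Finset.mem_insert_self i s)).add
      (ih fun j hj => hφ j (Finset.mem_insert_of_mem hj))

theorem laplacian_add (hφ : IsTestFunction φ) (hψ : IsTestFunction ψ) (x : RN N) :
    Laplacian.laplacian (fun y => φ y + ψ y) x =
      Laplacian.laplacian φ x + Laplacian.laplacian ψ x :=
  (hφ.contDiffAt_two x).laplacian_add (hψ.contDiffAt_two x)

theorem laplacian_sub (hφ : IsTestFunction φ) (hψ : IsTestFunction ψ) (x : RN N) :
    Laplacian.laplacian (fun y => φ y - ψ y) x =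
      Laplacian.laplacian φ x - Laplacian.laplacian ψ x :=
  (hφ.contDiffAt_two x).laplacian_sub (hψ.contDiffAt_two x)

theorem memLp (hφ : IsTestFunction φ) (s : ℝ≥0∞) : MemLp φ s volume :=
  hφ.1.continuous.memLp_of_hasCompactSupport hφ.2

theorem integrable (hφ : IsTestFunction φ) : Integrable φ :=
  hφ.1.continuous.integrable_of_hasCompactSupport hφ.2

theorem integrable_mul (hφ : IsTestFunction φ) (hψ : IsTestFunction ψ) :
    Integrable (fun x => φ x * ψ x) :=
  (hψ.smooth_mul hφ.1).integrable

theorem exists_bound (hφ : IsTestFunction φ) : ∃ C, 0 ≤ C ∧ ∀ x, |φ x| ≤ C := by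
  obtain ⟨C, hC⟩ := hφ.1.continuous.bounded_above_of_compact_support hφ.2
  exact ⟨C, (norm_nonneg _).trans (hC 0), hC⟩

/-- Green's second identity. -/
theorem integral_mul_laplacian (hφ : IsTestFunction φ) (hψ : IsTestFunction ψ) :
    ∫ x, φ x * Laplacian.laplacian ψ x = ∫ x, Laplacian.laplacian φ x * ψ x := by
  have h := SchwartzMap.integral_mul_laplacian_right_eq_left (μ := volume)
    (hφ.2.toSchwartzMap hφ.1) (hψ.2.toSchwartzMap hψ.1)
  simp_rw [SchwartzMap.laplacian_apply] at h
  exact h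

end IsTestFunction

/-! ### Weak Laplacians -/

theorem IsTestFunction.isWeakLaplacian {φ : RN N → ℝ} (hφ : IsTestFunction φ) :
    IsWeakLaplacian φ (Laplacian.laplacian φ) :=
  ⟨hφ.integrable.locallyIntegrable, hφ.laplacian.integrable.locallyIntegrable,
    fun _ hψ => hφ.integral_mul_laplacian hψ⟩

theorem IsWeakLaplacian.ae_eq {u g g' : RN N → ℝ} (h : IsWeakLaplacian u g)
    (h' : IsWeakLaplacian u g') : g =ᵐ[volume] g' := by
  refine ae_eq_of_integral_contDiff_smul_eq h.2.1 h'.2.1 fun ψ hψ hψc => ?_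
  simp_rw [smul_eq_mul, mul_comm (ψ _)]
  rw [← h.2.2 ψ ⟨hψ, hψc⟩, ← h'.2.2 ψ ⟨hψ, hψc⟩]

theorem IsWeakLaplacian.lapNorm_eq {u g : RN N → ℝ} (h : IsWeakLaplacian u g) (r : ℝ) :
    lapNorm r u = eLpNorm g (ENNReal.ofReal r) volume :=
  le_antisymm (iInf₂_le g h) (le_iInf₂ fun _ h' => (eLpNorm_congr_ae (h.ae_eq h')).le)

theorem tendsto_integral_mul_of_eLpNorm {s : ℝ≥0∞} (hs : 1 ≤ s) {f : ℕ → RN N → ℝ} {f₀ ψ : RN N → ℝ}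
    (hf : ∀ n, MemLp (f n) s volume) (hf₀ : MemLp f₀ s volume) (hψ : IsTestFunction ψ)
    (h : Tendsto (fun n => eLpNorm (fun x => f n x - f₀ x) s volume) atTop (𝓝 0)) :
    Tendsto (fun n => ∫ x, f n x * ψ x) atTop (𝓝 (∫ x, f₀ x * ψ x)) := by
  have hst := ENNReal.HolderConjugate.conjExponent hs
  have hψs := hψ.memLp (ENNReal.conjExponent s)
  refine tendsto_integral_of_L1' (fun x => f₀ x * ψ x) ?_
    (Eventually.of_forall fun n => ((hf n).integrable_mul hψs)) ?_
  · exact (hf₀.integrable_mul hψs).1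
  refine tendsto_of_tendsto_of_tendsto_of_le_of_le (tendsto_const_nhds)
    (?_ : Tendsto (fun n => eLpNorm (fun x => f n x - f₀ x) s volume *
      eLpNorm ψ (ENNReal.conjExponent s) volume) atTop (𝓝 0)) (fun _ => zero_le) fun n => ?_
  · simpa using ENNReal.Tendsto.mul_const h (Or.inr hψs.2.ne)
  · have := eLpNorm_smul_le_mul_eLpNorm (r := 1) hψs.1 ((hf n).sub hf₀).1 (p := s)
      (q := ENNReal.conjExponent s)
    refine le_trans (le_of_eq ?_) this
    congr 1
    ext x
    simp [sub_mul]

/-- The weak Laplacian is a closed operator. -/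
theorem isWeakLaplacian_of_tendsto {s t : ℝ≥0∞} (hs : 1 ≤ s) (ht : 1 ≤ t)
    {φ : ℕ → RN N → ℝ} {u g : RN N → ℝ} (hφ : ∀ n, IsTestFunction (φ n))
    (hu : MemLp u s volume) (hg : MemLp g t volume)
    (h : Tendsto (fun n => eLpNorm (fun x => φ n x - u x) s volume) atTop (𝓝 0))
    (h' : Tendsto (fun n => eLpNorm (fun x => Laplacian.laplacian (φ n) x - g x) t volume)
      atTop (𝓝 0)) :
    IsWeakLaplacian u g := by
  refine ⟨hu.locallyIntegrable hs, hg.locallyIntegrable ht, fun ψ hψ => ?_⟩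
  have h1 := tendsto_integral_mul_of_eLpNorm hs (fun n => (hφ n).memLp s) hu hψ.laplacian h
  have h2 := tendsto_integral_mul_of_eLpNorm ht (fun n => (hφ n).laplacian.memLp t) hg hψ h'
  refine tendsto_nhds_unique h1 (h2.congr fun n => ?_)
  exact ((hφ n).integral_mul_laplacian hψ).symm

/-! ### Cutting off near the origin -/

/-- Functions of size `(k + 1)^m` supported in the ball of radius `2 / (k + 1)` tend to zero in `L^s`
if `m < N / s`. -/
theorem tendsto_eLpNorm_of_concentrating (hN : 0 < N) {s m C : ℝ} (hs : 0 < s) (hm : m < N / s)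
    (hC : 0 ≤ C) {f : ℕ → RN N → ℝ} (hb : ∀ (k : ℕ) x, |f k x| ≤ C * ((k : ℝ) + 1) ^ m)
    (hz : ∀ (k : ℕ) x, 2 / ((k : ℝ) + 1) < ‖x‖ → f k x = 0) :
    Tendsto (fun k => eLpNorm (f k) (ENNReal.ofReal s) volume) atTop (𝓝 0) := by
  have : Nonempty (Fin N) := ⟨⟨0, hN⟩⟩
  set V : ℝ := (volume (Metric.ball (0 : RN N) 1)).toReal with hV
  have hVt : volume (Metric.ball (0 : RN N) 1) = ENNReal.ofReal V :=
    (ENNReal.ofReal_toReal measure_ball_lt_top.ne).symm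
  have key (k : ℕ) : eLpNorm (f k) (ENNReal.ofReal s) volume ≤
      ENNReal.ofReal (C * 2 ^ (N / s) * V ^ (1 / s) * ((k : ℝ) + 1) ^ (-(N / s - m))) := by
    have hk : (0 : ℝ) < k + 1 := by positivity
    have h1 : eLpNorm (f k) (ENNReal.ofReal s) volume ≤
        eLpNorm ((Metric.closedBall (0 : RN N) (2 / ((k : ℝ) + 1))).indicator
          fun _ => C * ((k : ℝ) + 1) ^ m) (ENNReal.ofReal s) volume := by
      refine eLpNorm_mono fun x => ?_
      by_cases hx : x ∈ Metric.closedBall (0 : RN N) (2 / ((k : ℝ) + 1))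
      · rw [Set.indicator_of_mem hx, Real.norm_eq_abs]
        exact (hb k x).trans (le_abs_self _)
      · rw [mem_closedBall_zero_iff, not_le] at hx
        simp [hz k x hx]
    refine h1.trans ((eLpNorm_indicator_const_le _ _).trans (le_of_eq ?_))
    rw [Measure.addHaar_closedBall _ _ (by positivity), hVt, ENNReal.toReal_ofReal hs.le,
      ← ENNReal.ofReal_mul (by positivity), ENNReal.ofReal_rpow_of_nonneg (by positivity)
      (by positivity), Real.enorm_eq_ofReal (by positivity), ← ENNReal.ofReal_mul (by positivity)]
    congr 1
    rw [Real.mul_rpow (by positivity) (by positivity), finrank_euclideanSpace, Fintype.card_fin,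
      ← Real.rpow_natCast, ← Real.rpow_mul (by positivity), Real.div_rpow (by positivity) hk.le,
      neg_sub, Real.rpow_sub hk, mul_one_div]
    ring
  refine tendsto_of_tendsto_of_tendsto_of_le_of_le tendsto_const_nhds ?_ (fun _ => zero_le) key
  rw [← ENNReal.ofReal_zero]
  refine ENNReal.tendsto_ofReal ?_
  have h2 : Tendsto (fun k : ℕ => ((k : ℝ) + 1) ^ (-(N / s - m))) atTop (𝓝 0) :=
    (tendsto_rpow_neg_atTop (sub_pos.2 hm)).comp
      (tendsto_atTop_add_const_right _ _ tendsto_natCast_atTop_atTop)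
  simpa using h2.const_mul (C * 2 ^ (N / s) * V ^ (1 / s))

theorem partialDeriv_dilation {χ : RN N → ℝ} (hχ : Differentiable ℝ χ) (κ : ℝ) (i : Fin N) :
    partialDeriv i (fun x => χ (κ • x)) = fun x => κ * partialDeriv i χ (κ • x) := by
  ext x
  have h1 : HasFDerivAt (fun x : RN N => κ • x) (κ • ContinuousLinearMap.id ℝ (RN N)) x :=
    (hasFDerivAt_id x).const_smul κ
  have h2 := ((hχ (κ • x)).hasFDerivAt.comp x h1).fderiv
  simp only [Function.comp_def] at h2
  simp [partialDeriv, h2]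

theorem laplacian_dilation {χ : RN N → ℝ} (hχ : ContDiff ℝ ∞ χ) (κ : ℝ) (x : RN N) :
    Laplacian.laplacian (fun x => χ (κ • x)) x = κ ^ 2 * Laplacian.laplacian χ (κ • x) := by
  have h2 : (2 : WithTop ℕ∞) ≤ (∞ : WithTop ℕ∞) := WithTop.coe_le_coe.2 le_top
  have hs : ContDiff ℝ ∞ (fun x : RN N => χ (κ • x)) := hχ.comp (contDiff_const_smul κ)
  rw [laplacian_eq_sum_partialDeriv (hs.contDiffAt.of_le h2),
    laplacian_eq_sum_partialDeriv (hχ.contDiffAt.of_le h2), Finset.mul_sum]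
  refine Finset.sum_congr rfl fun i _ => ?_
  have hd : Differentiable ℝ (partialDeriv i χ) := (hχ.partialDeriv i).differentiable (by simp)
  have hd' : DifferentiableAt ℝ (fun x : RN N => partialDeriv i χ (κ • x)) x :=
    (hd.comp (differentiable_id.const_smul κ)) x
  rw [partialDeriv_dilation (hχ.differentiable (by simp)), partialDeriv_const_mul i κ hd',
    partialDeriv_dilation hd]
  ring

/-- Since points have zero capacity for `D^{2,r}` with `r < N / 2`, a test function can be
approximated by test functions that vanish near the origin. -/
theorem IsTestFunction.exists_approx_vanishing (hN : 0 < N) {p r : ℝ} (hp : 0 < p) (hr : 0 < r)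
    (hrN : 2 < N / r) {φ : RN N → ℝ} (hφ : IsTestFunction φ) :
    ∃ ψ : ℕ → RN N → ℝ, (∀ k, IsTestFunction (ψ k)) ∧ (∀ k, ψ k =ᶠ[𝓝 0] 0) ∧
      Tendsto (fun k => eLpNorm (fun x => ψ k x - φ x) (ENNReal.ofReal p) volume) atTop (𝓝 0) ∧
      Tendsto (fun k => eLpNorm (fun x => Laplacian.laplacian (ψ k) x - Laplacian.laplacian φ x)
        (ENNReal.ofReal r) volume) atTop (𝓝 0) := by
  let χ : ContDiffBump (0 : RN N) := ⟨1, 2, one_pos, one_lt_two⟩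
  have hχ : IsTestFunction χ := ⟨χ.contDiff, χ.hasCompactSupport⟩
  set ζ : ℕ → RN N → ℝ := fun k x => χ (((k : ℝ) + 1) • x) with hζ
  have hζs (k : ℕ) : ContDiff ℝ ∞ (ζ k) := hχ.1.comp (contDiff_const_smul _)
  have hw (k : ℕ) : IsTestFunction (fun x => ζ k x * φ x) := hφ.smooth_mul (hζs k)
  have hψ (k : ℕ) : IsTestFunction (fun x => φ x - ζ k x * φ x) := hφ.sub (hw k)
  have hzero (k : ℕ) (x : RN N) (hx : 2 / ((k : ℝ) + 1) < ‖x‖) :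
      ∀ᶠ y in 𝓝 x, ζ k y * φ y = 0 := by
    have ho : IsOpen {y : RN N | 2 / ((k : ℝ) + 1) < ‖y‖} :=
      isOpen_lt continuous_const continuous_norm
    filter_upwards [ho.mem_nhds hx] with y hy
    have : ζ k y = 0 := by
      refine χ.zero_of_le_dist ?_
      rw [dist_zero_right, norm_smul, Real.norm_of_nonneg (by positivity)]
      exact ((div_lt_iff₀' (by positivity)).1 hy).le
    rw [this, zero_mul]
  obtain ⟨A, hA, hφA⟩ := hφ.exists_bound
  obtain ⟨A', hA', hφA'⟩ := hφ.laplacian.exists_bound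
  obtain ⟨B, hB, hχB⟩ := hχ.laplacian.exists_bound
  choose D hD hφD using fun i => (hφ.partialDeriv i).exists_bound
  choose E hE hχE using fun i => (hχ.partialDeriv i).exists_bound
  have hχ1 (x : RN N) : |χ x| ≤ 1 := by
    rw [abs_of_nonneg χ.nonneg]; exact χ.le_one
  refine ⟨fun k x => φ x - ζ k x * φ x, hψ, fun k => ?_, ?_, ?_⟩
  · have hm : (fun y : RN N => ((k : ℝ) + 1) • y) ⁻¹' Metric.ball 0 1 ∈ 𝓝 (0 : RN N) :=
      (continuous_const_smul _).continuousAt.preimage_mem_nhds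
        (by simpa using Metric.ball_mem_nhds (0 : RN N) one_pos)
    filter_upwards [hm] with y hy
    have : ζ k y = 1 := χ.one_of_mem_closedBall (Metric.ball_subset_closedBall hy)
    simp [this]
  · have h := tendsto_eLpNorm_of_concentrating hN hp (m := 0) (C := A) (by positivity) hA
      (f := fun k x => ζ k x * φ x) (fun k x => by
        rw [abs_mul, Real.rpow_zero, mul_one]
        exact (mul_le_of_le_one_left (abs_nonneg _) (hχ1 _)).trans (hφA x))
      (fun k x hx => (hzero k x hx).self_of_nhds)
    refine h.congr fun k => ?_
    rw [← eLpNorm_neg]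
    congr 1
    ext x
    simp
  · have hb (k : ℕ) (x : RN N) : |Laplacian.laplacian (fun x => ζ k x * φ x) x| ≤
        (A' + 2 * ∑ i, E i * D i + B * A) * ((k : ℝ) + 1) ^ (2 : ℝ) := by
      have hk : (1 : ℝ) ≤ k + 1 := by linarith [k.cast_nonneg (α := ℝ)]
      rw [laplacian_mul ((hζs k).contDiffAt.of_le (WithTop.coe_le_coe.2 le_top))
        (hφ.contDiffAt_two x), hζ, laplacian_dilation hχ.1]
      simp_rw [partialDeriv_dilation (hχ.1.differentiable (by simp))]
      generalize (k : ℝ) + 1 = κ at hk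
      have hk0 : 0 ≤ κ := by linarith
      have hk2 : 1 ≤ κ ^ 2 := one_le_pow₀ hk
      have hk3 : κ ≤ κ ^ 2 := le_self_pow₀ hk (by norm_num)
      have t1 : |χ (κ • x) * Laplacian.laplacian φ x| ≤ A' * κ ^ 2 := by
        rw [abs_mul]
        calc _ ≤ 1 * A' := by gcongr; exacts [hχ1 _, hφA' x]
          _ ≤ A' * κ ^ 2 := by rw [one_mul]; exact le_mul_of_one_le_right hA' hk2
      have t2 : |∑ i, κ * partialDeriv i χ (κ • x) * partialDeriv i φ x| ≤
          (∑ i, E i * D i) * κ ^ 2 := by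
        rw [Finset.sum_mul]
        refine (Finset.abs_sum_le_sum_abs _ _).trans (Finset.sum_le_sum fun i _ => ?_)
        rw [abs_mul, abs_mul, abs_of_nonneg hk0]
        calc _ ≤ κ ^ 2 * E i * D i := by
              have := hE i
              gcongr
              exacts [hχE i _, hφD i x]
          _ = _ := by ring
      have t3 : |κ ^ 2 * Laplacian.laplacian (χ : RN N → ℝ) (κ • x) * φ x| ≤ B * A * κ ^ 2 := by
        rw [abs_mul, abs_mul, abs_of_nonneg (by positivity)]
        calc _ ≤ κ ^ 2 * B * A := by gcongr; exacts [hχB _, hφA x]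
          _ = _ := by ring
      rw [Real.rpow_two]
      refine (abs_add_le _ _).trans ?_
      have := abs_add_le (χ (κ • x) * Laplacian.laplacian φ x)
        (2 * ∑ i, κ * partialDeriv i χ (κ • x) * partialDeriv i φ x)
      rw [abs_mul 2, abs_two] at this
      linarith
    have hC : 0 ≤ A' + 2 * ∑ i, E i * D i + B * A := by
      have : 0 ≤ ∑ i, E i * D i := Finset.sum_nonneg fun i _ => mul_nonneg (hE i) (hD i)
      positivity
    have h := tendsto_eLpNorm_of_concentrating hN hr hrN hC hb
      (fun k x hx => laplacian_eq_zero_of_eventuallyEq (hzero k x hx))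
    refine h.congr fun k => ?_
    rw [← eLpNorm_neg]
    congr 1
    ext x
    simp [hφ.laplacian_sub (hw k)]

/-! ### The space `D^{2,r}` under the inversion -/

/-- Test functions that vanish near the origin are dense in `D^{2,r}`. -/
theorem exists_approx_of_mem_D2 (hN : 0 < N) {p r : ℝ} (hp : 1 ≤ p) (hr : 1 ≤ r)
    (hrN : 2 < N / r) {u : RN N → ℝ} (hu : u ∈ D2 N p r) :
    ∃ g : RN N → ℝ, IsWeakLaplacian u g ∧ MemLp g (ENNReal.ofReal r) volume ∧
      ∃ φ : ℕ → RN N → ℝ, (∀ n, IsTestFunction (φ n)) ∧ (∀ n, φ n =ᶠ[𝓝 0] 0) ∧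
        Tendsto (fun n => eLpNorm (fun x => φ n x - u x) (ENNReal.ofReal p) volume)
          atTop (𝓝 0) ∧
        Tendsto (fun n => eLpNorm (fun x => Laplacian.laplacian (φ n) x - g x)
          (ENNReal.ofReal r) volume) atTop (𝓝 0) := by
  obtain ⟨hup, g, hg, hgr, φ, hφ, h1, h2⟩ := hu
  refine ⟨g, hg, hgr, ?_⟩
  have hp1 : 1 ≤ ENNReal.ofReal p := by simpa using ENNReal.ofReal_le_ofReal hp
  have hr1 : 1 ≤ ENNReal.ofReal r := by simpa using ENNReal.ofReal_le_ofReal hr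
  have hε (n : ℕ) : (0 : ℝ≥0∞) < ((n : ℝ≥0∞) + 1)⁻¹ := by
    simp [ENNReal.inv_pos, ENNReal.add_eq_top]
  have key (n : ℕ) : ∃ ψ : RN N → ℝ, IsTestFunction ψ ∧ ψ =ᶠ[𝓝 0] 0 ∧
      eLpNorm (fun x => ψ x - φ n x) (ENNReal.ofReal p) volume ≤ ((n : ℝ≥0∞) + 1)⁻¹ ∧
      eLpNorm (fun x => Laplacian.laplacian ψ x - Laplacian.laplacian (φ n) x)
        (ENNReal.ofReal r) volume ≤ ((n : ℝ≥0∞) + 1)⁻¹ := by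
    obtain ⟨ψ, hψ, hψ0, hψ1, hψ2⟩ := (hφ n).exists_approx_vanishing hN
      (zero_lt_one.trans_le hp) (zero_lt_one.trans_le hr) hrN
    obtain ⟨k, hk1, hk2⟩ := ((hψ1.eventually_le_const (hε n)).and
      (hψ2.eventually_le_const (hε n))).exists
    exact ⟨ψ k, hψ k, hψ0 k, hk1, hk2⟩
  choose ψ hψ hψ0 hψ1 hψ2 using key
  have hlim : Tendsto (fun n : ℕ => ((n : ℝ≥0∞) + 1)⁻¹) atTop (𝓝 0) := by
    have h := ENNReal.tendsto_inv_nat_nhds_zero.comp (tendsto_add_atTop_nat 1)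
    refine h.congr fun n => ?_
    simp
  refine ⟨ψ, hψ, hψ0, ?_, ?_⟩
  · refine tendsto_of_tendsto_of_tendsto_of_le_of_le tendsto_const_nhds
      (by simpa using hlim.add h1) (fun _ => zero_le) fun n => ?_
    have := eLpNorm_add_le (((hψ n).sub (hφ n)).memLp (ENNReal.ofReal p)).1
      (((hφ n).memLp (ENNReal.ofReal p)).sub hup).1 hp1
    refine le_trans (le_of_eq ?_) (this.trans (add_le_add_left (hψ1 n) _))
    congr 1
    ext x
    simp
  · refine tendsto_of_tendsto_of_tendsto_of_le_of_le tendsto_const_nhds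
      (by simpa using hlim.add h2) (fun _ => zero_le) fun n => ?_
    have := eLpNorm_add_le (((hψ n).laplacian.sub (hφ n).laplacian).memLp (ENNReal.ofReal r)).1
      (((hφ n).laplacian.memLp (ENNReal.ofReal r)).sub hgr).1 hr1
    refine le_trans (le_of_eq ?_) (this.trans (add_le_add_left (hψ2 n) _))
    congr 1
    ext x
    simp

/-- Completeness of `L^s`, transported along an isometry: if `F n` has the same mutual distances in
`L^s` as a convergent sequence `G n`, then it converges too. -/
theorem exists_limit_of_eLpNorm_sub_eq {s : ℝ≥0∞} (hs : 1 ≤ s) {F G : ℕ → RN N → ℝ}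
    {g : RN N → ℝ} (hF : ∀ n, MemLp (F n) s volume) (hG : ∀ n, MemLp (G n) s volume)
    (hg : MemLp g s volume)
    (hlim : Tendsto (fun n => eLpNorm (fun x => G n x - g x) s volume) atTop (𝓝 0))
    (hiso : ∀ n m, eLpNorm (fun x => F n x - F m x) s volume =
      eLpNorm (fun x => G n x - G m x) s volume) :
    ∃ f : RN N → ℝ, MemLp f s volume ∧
      Tendsto (fun n => eLpNorm (fun x => F n x - f x) s volume) atTop (𝓝 0) := by
  have : Fact (1 ≤ s) := ⟨hs⟩
  have hGt : Tendsto (fun n => (hG n).toLp (G n)) atTop (𝓝 (hg.toLp g)) :=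
    (Lp.tendsto_Lp_iff_tendsto_eLpNorm'' G hG g hg).2 hlim
  have hGc := EMetric.cauchySeq_iff.1 hGt.cauchySeq
  have hFc : CauchySeq (fun n => (hF n).toLp (F n)) := by
    refine EMetric.cauchySeq_iff.2 fun ε hε => ?_
    obtain ⟨M, hM⟩ := hGc ε hε
    refine ⟨M, fun m hm n hn => ?_⟩
    have := hM m hm n hn
    rw [Lp.edist_toLp_toLp] at this ⊢
    exact (hiso m n).trans_lt this
  obtain ⟨f, hf⟩ := cauchySeq_tendsto_of_complete hFc
  refine ⟨f, Lp.memLp f, ?_⟩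
  refine (Lp.tendsto_Lp_iff_tendsto_eLpNorm'' F hF f (Lp.memLp f)).1 ?_
  rwa [Lp.toLp_coeFn]

theorem tendsto_eLpNorm_of_tendsto_sub {s : ℝ≥0∞} (hs : 1 ≤ s) {F : ℕ → RN N → ℝ}
    {f : RN N → ℝ} (hF : ∀ n, MemLp (F n) s volume) (hf : MemLp f s volume)
    (hlim : Tendsto (fun n => eLpNorm (fun x => F n x - f x) s volume) atTop (𝓝 0)) :
    Tendsto (fun n => eLpNorm (F n) s volume) atTop (𝓝 (eLpNorm f s volume)) := by
  have : Fact (1 ≤ s) := ⟨hs⟩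
  have h := ((Lp.tendsto_Lp_iff_tendsto_eLpNorm'' F hF f hf).2 hlim).enorm
  simpa [Lp.enorm_toLp] using h

/-- If the conformal pullback preserves `‖Δ·‖_r` on test functions that vanish near the origin, then
it maps `D^{2,r}` to itself and preserves the norm there. -/
theorem conformalPullback_mem_D2 (hN : 0 < N) {p r : ℝ} (hp : 1 ≤ p) (hr : 1 ≤ r)
    (hrN : 2 < N / r)
    (hiso : ∀ φ : RN N → ℝ, IsTestFunction φ → φ =ᶠ[𝓝 0] 0 →
      eLpNorm (Laplacian.laplacian (conformalPullback p (unitInversion N) φ))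
        (ENNReal.ofReal r) volume = eLpNorm (Laplacian.laplacian φ) (ENNReal.ofReal r) volume)
    {u : RN N → ℝ} (hu : u ∈ D2 N p r) :
    conformalPullback p (unitInversion N) u ∈ D2 N p r ∧
      lapNorm r (conformalPullback p (unitInversion N) u) = lapNorm r u := by
  have hp0 := zero_lt_one.trans_le hp
  have hp1 : 1 ≤ ENNReal.ofReal p := by simpa using ENNReal.ofReal_le_ofReal hp
  have hr1 : 1 ≤ ENNReal.ofReal r := by simpa using ENNReal.ofReal_le_ofReal hr
  obtain ⟨g, hg, hgr, φ, hφ, hφ0, h1, h2⟩ := exists_approx_of_mem_D2 hN hp hr hrN hu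
  set T := conformalPullback p (unitInversion N) with hT
  have hTφ (n : ℕ) : IsTestFunction (T (φ n)) :=
    (isTestFunction_conformalPullback p (hφ n) (hφ0 n)).1
  have hTu : MemLp (T u) (ENNReal.ofReal p) volume := hu.1.conformalPullback hN hp0
  have hTlim : Tendsto (fun n => eLpNorm (fun x => T (φ n) x - T u x) (ENNReal.ofReal p) volume)
      atTop (𝓝 0) := by
    refine h1.congr fun n => ?_
    rw [← eLpNorm_conformalPullback hN hp0]
    congr 1
    ext x
    exact conformalPullback_sub p _ _ _ x
  have hpair (n m : ℕ) : eLpNorm (fun x => Laplacian.laplacian (T (φ n)) x -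
        Laplacian.laplacian (T (φ m)) x) (ENNReal.ofReal r) volume =
      eLpNorm (fun x => Laplacian.laplacian (φ n) x - Laplacian.laplacian (φ m) x)
        (ENNReal.ofReal r) volume := by
    have h := hiso _ ((hφ n).sub (hφ m)) (by
      filter_upwards [hφ0 n, hφ0 m] with x hx hx'
      simp [hx, hx'])
    rw [show (fun x => Laplacian.laplacian (φ n) x - Laplacian.laplacian (φ m) x) =
      Laplacian.laplacian (fun x => φ n x - φ m x) from
        funext fun x => ((hφ n).laplacian_sub (hφ m) x).symm, ← h]
    congr 1
    ext x
    rw [← (hTφ n).laplacian_sub (hTφ m)]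
    exact congrArg (fun v : RN N → ℝ => (Laplacian.laplacian v : RN N → ℝ) x)
      (funext fun y => (conformalPullback_sub p _ _ _ y).symm)
  obtain ⟨f, hf, hflim⟩ := exists_limit_of_eLpNorm_sub_eq hr1
    (fun n => (hTφ n).laplacian.memLp _) (fun n => (hφ n).laplacian.memLp _) hgr h2 hpair
  have hweak : IsWeakLaplacian (T u) f :=
    isWeakLaplacian_of_tendsto hp1 hr1 hTφ hTu hf hTlim hflim
  refine ⟨⟨hTu, f, hweak, hf, fun n => T (φ n), hTφ, hTlim, hflim⟩, ?_⟩
  rw [hweak.lapNorm_eq, hg.lapNorm_eq]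
  refine tendsto_nhds_unique (tendsto_eLpNorm_of_tendsto_sub hr1
    (fun n => (hTφ n).laplacian.memLp _) hf hflim) ?_
  refine (tendsto_eLpNorm_of_tendsto_sub hr1 (fun n => (hφ n).laplacian.memLp _) hgr h2).congr
    fun n => ?_
  exact (hiso _ (hφ n) (hφ0 n)).symm

theorem IsTestFunction.mem_D2 {φ : RN N → ℝ} (hφ : IsTestFunction φ) (p r : ℝ) :
    φ ∈ D2 N p r :=
  ⟨hφ.memLp _, _, hφ.isWeakLaplacian, hφ.laplacian.memLp _, fun _ => φ, fun _ => hφ,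
    by simp, by simp⟩

/-! ### The Rellich-type identity behind the case `q = 2` -/

/-- The Euler operator `w ↦ x · ∇w`. -/
noncomputable def euler (w : RN N → ℝ) : RN N → ℝ := fun x => ∑ i, x i * partialDeriv i w x

protected theorem IsTestFunction.euler {w : RN N → ℝ} (hw : IsTestFunction w) :
    IsTestFunction (euler w) :=
  IsTestFunction.sum fun i _ => (hw.partialDeriv i).smooth_mul (contDiff_coord i)

/-- The formal adjoint of the Euler operator is `v ↦ -(x · ∇v) - N v`. -/
theorem integral_euler_mul {w v : RN N → ℝ} (hw : IsTestFunction w) (hv : IsTestFunction v) :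
    ∫ x, euler w x * v x = -(∫ x, w x * euler v x) - N * ∫ x, w x * v x := by
  have hx (i : Fin N) : IsTestFunction (fun x : RN N => x i * v x) :=
    hv.smooth_mul (contDiff_coord i)
  have hd (i : Fin N) (x : RN N) : partialDeriv i (fun x : RN N => x i * v x) x =
      x i * partialDeriv i v x + v x := by
    rw [partialDeriv_mul i (hasFDerivAt_coord i x).differentiableAt (hv.differentiableAt x),
      partialDeriv_coord]
    simp
  have h1 (i : Fin N) : ∫ x, x i * partialDeriv i w x * v x =
      -(∫ x, w x * (x i * partialDeriv i v x)) - ∫ x, w x * v x := by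
    have hxv : IsTestFunction (fun x : RN N => x i * partialDeriv i v x) :=
      (hv.partialDeriv i).smooth_mul (contDiff_coord i)
    have h := integral_mul_fderiv_eq_neg_fderiv_mul_of_integrable (μ := volume)
      (f := fun x : RN N => x i * v x) (g := w) (v := EuclideanSpace.single i 1)
      (((hx i).partialDeriv i).integrable_mul hw) ((hx i).integrable_mul (hw.partialDeriv i))
      ((hx i).integrable_mul hw) (fun x _ => (hx i).differentiableAt x)
      (fun x _ => hw.differentiableAt x)
    have h' : ∫ x, x i * v x * partialDeriv i w x =
      -∫ x, partialDeriv i (fun x : RN N => x i * v x) x * w x := h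
    simp_rw [hd] at h'
    rw [← neg_add', ← integral_add (hw.integrable_mul hxv) (hw.integrable_mul hv)]
    calc _ = ∫ x, x i * v x * partialDeriv i w x := integral_congr_ae (.of_forall fun x => by ring)
      _ = _ := h'
      _ = _ := congrArg Neg.neg (integral_congr_ae (.of_forall fun x => by ring))
  calc ∫ x, euler w x * v x = ∑ i, ∫ x, x i * partialDeriv i w x * v x := by
        rw [← integral_finsetSum _ fun i _ =>
          ((hw.partialDeriv i).smooth_mul (contDiff_coord i)).integrable_mul hv]
        simp only [euler, Finset.sum_mul]
    _ = -(∑ i, ∫ x, w x * (x i * partialDeriv i v x)) - N * ∫ x, w x * v x := by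
        simp_rw [h1, Finset.sum_sub_distrib, Finset.sum_neg_distrib]
        simp
    _ = _ := by
        rw [← integral_finsetSum _ fun i _ =>
          hw.integrable_mul ((hv.partialDeriv i).smooth_mul (contDiff_coord i))]
        simp only [euler, Finset.mul_sum]

theorem laplacian_partialDeriv {w : RN N → ℝ} (hw : IsTestFunction w) (i : Fin N) (x : RN N) :
    Laplacian.laplacian (partialDeriv i w) x = partialDeriv i (Laplacian.laplacian w) x := by
  have hΔ : Laplacian.laplacian w = fun x => ∑ j, partialDeriv j (partialDeriv j w) x :=
    funext fun x => laplacian_eq_sum_partialDeriv (hw.contDiffAt_two x)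
  rw [laplacian_eq_sum_partialDeriv ((hw.partialDeriv i).contDiffAt_two x), hΔ,
    partialDeriv_sum i fun j _ => ((hw.partialDeriv j).partialDeriv j).differentiableAt x]
  refine Finset.sum_congr rfl fun j _ => ?_
  rw [partialDeriv_comm hw.1 j i, partialDeriv_comm (hw.partialDeriv j).1 j i]

theorem laplacian_euler {w : RN N → ℝ} (hw : IsTestFunction w) (x : RN N) :
    Laplacian.laplacian (euler w) x =
      euler (Laplacian.laplacian w) x + 2 * Laplacian.laplacian w x := by
  have hi (i : Fin N) : IsTestFunction (fun x : RN N => x i * partialDeriv i w x) :=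
    (hw.partialDeriv i).smooth_mul (contDiff_coord i)
  have hs (s : Finset (Fin N)) : Laplacian.laplacian
      (fun x => ∑ i ∈ s, x i * partialDeriv i w x) x =
      ∑ i ∈ s, Laplacian.laplacian (fun x : RN N => x i * partialDeriv i w x) x := by
    induction s using Finset.induction_on with
    | empty => simp [laplacian_eq_zero_of_eventuallyEq (c := 0) (EventuallyEq.refl _ _)]
    | insert i s his ih =>
      simp_rw [Finset.sum_insert his]
      rw [(hi i).laplacian_add (IsTestFunction.sum fun j _ => hi j), ih]
  unfold euler
  rw [hs, laplacian_eq_sum_partialDeriv (hw.contDiffAt_two x), Finset.mul_sum,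
    ← Finset.sum_add_distrib]
  refine Finset.sum_congr rfl fun i _ => ?_
  rw [laplacian_coord_mul i ((hw.partialDeriv i).contDiffAt_two x), laplacian_partialDeriv hw]

theorem partialDeriv_norm_sq (i : Fin N) (x : RN N) :
    partialDeriv i (fun y : RN N => ‖y‖ ^ 2) x = 2 * x i := by
  simp [partialDeriv, (hasStrictFDerivAt_norm_sq x).hasFDerivAt.fderiv,
    EuclideanSpace.inner_single_right]

theorem laplacian_norm_sq (x : RN N) :
    Laplacian.laplacian (fun y : RN N => ‖y‖ ^ 2) x = 2 * N := by
  rw [laplacian_eq_sum_partialDeriv (contDiff_norm_sq ℝ).contDiffAt]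
  simp_rw [funext (partialDeriv_norm_sq (N := N) _)]
  simp [partialDeriv_const_mul _ _ (hasFDerivAt_coord _ x).differentiableAt, partialDeriv_coord,
    mul_comm]

theorem laplacian_norm_sq_mul {w : RN N → ℝ} (hw : IsTestFunction w) (x : RN N) :
    Laplacian.laplacian (fun y => ‖y‖ ^ 2 * w y) x =
      ‖x‖ ^ 2 * Laplacian.laplacian w x + 4 * euler w x + 2 * N * w x := by
  rw [laplacian_mul (contDiff_norm_sq ℝ).contDiffAt (hw.contDiffAt_two x), laplacian_norm_sq]
  simp_rw [partialDeriv_norm_sq, euler, mul_assoc, ← Finset.mul_sum]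
  ring

theorem euler_norm_sq_mul {w : RN N → ℝ} (hw : IsTestFunction w) (x : RN N) :
    euler (fun y => ‖y‖ ^ 2 * w y) x = ‖x‖ ^ 2 * euler w x + 2 * (‖x‖ ^ 2 * w x) := by
  have h (i : Fin N) : x i * partialDeriv i (fun y => ‖y‖ ^ 2 * w y) x =
      ‖x‖ ^ 2 * (x i * partialDeriv i w x) + 2 * w x * (x i) ^ 2 := by
    rw [partialDeriv_mul i (hasStrictFDerivAt_norm_sq x).hasFDerivAt.differentiableAt
      (hw.differentiableAt x), partialDeriv_norm_sq]
    ring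
  simp_rw [euler, h, Finset.sum_add_distrib, ← Finset.mul_sum, ← EuclideanSpace.real_norm_sq_eq]
  ring

/-- Put `z = |x|² w`, so that `|x|² Δw - Δz = -(4 x·∇w + 2 N w)`. The difference of the two sides is
the `L²` product of this first order operator with `|x|² Δw + Δz`. It vanishes because
`Δ(|x|² x·∇w) = x·∇(Δz)` and the adjoint of `x·∇` is `-x·∇ - N`. -/
theorem integral_sq_norm_sq_mul_laplacian {w : RN N → ℝ} (hw : IsTestFunction w) :
    ∫ x, (‖x‖ ^ 2 * Laplacian.laplacian w x) ^ 2 =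
      ∫ x, (Laplacian.laplacian (fun y => ‖y‖ ^ 2 * w y) x) ^ 2 := by
  set z : RN N → ℝ := fun y => ‖y‖ ^ 2 * w y with hz_def
  have hz : IsTestFunction z := hw.smooth_mul (contDiff_norm_sq ℝ)
  have hm : IsTestFunction (fun x => ‖x‖ ^ 2 * Laplacian.laplacian w x) :=
    hw.laplacian.smooth_mul (contDiff_norm_sq ℝ)
  have h1 : ∫ x, ‖x‖ ^ 2 * Laplacian.laplacian w x * euler w x =
      -(∫ x, euler w x * Laplacian.laplacian z x) - N * ∫ x, w x * Laplacian.laplacian z x := by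
    have e1 : ∫ x, ‖x‖ ^ 2 * Laplacian.laplacian w x * euler w x =
        (∫ x, Laplacian.laplacian w x * euler z x) - ∫ x, 2 * (Laplacian.laplacian w x * z x) := by
      rw [← integral_sub (hw.laplacian.integrable_mul hz.euler)
        ((hw.laplacian.integrable_mul hz).const_mul 2)]
      congr 1
      ext x
      rw [hz_def, euler_norm_sq_mul hw]
      ring
    have e2 : ∫ x, w x * Laplacian.laplacian (euler z) x =
        (∫ x, w x * euler (Laplacian.laplacian z) x) +
          ∫ x, 2 * (w x * Laplacian.laplacian z x) := by
      rw [← integral_add (hw.integrable_mul hz.laplacian.euler)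
        ((hw.integrable_mul hz.laplacian).const_mul 2)]
      congr 1
      ext x
      rw [laplacian_euler hz]
      ring
    have e3 := integral_euler_mul hw hz.laplacian
    rw [e1, ← hw.integral_mul_laplacian hz.euler, e2, integral_const_mul, integral_const_mul,
      ← hw.integral_mul_laplacian hz]
    linarith
  have h2 : ∫ x, w x * (‖x‖ ^ 2 * Laplacian.laplacian w x) =
      ∫ x, w x * Laplacian.laplacian z x := by
    rw [hw.integral_mul_laplacian hz]
    congr 1
    ext x
    rw [hz_def]
    ring
  rw [← sub_eq_zero]
  have i1 := (hm.integrable_mul hw.euler).const_mul 4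
  have i2 := (hw.euler.integrable_mul hz.laplacian).const_mul 4
  have i3 := (hw.integrable_mul hm).const_mul (2 * N : ℝ)
  have i4 := (hw.integrable_mul hz.laplacian).const_mul (2 * N : ℝ)
  have s1 : Integrable (fun x => (‖x‖ ^ 2 * Laplacian.laplacian w x) ^ 2) := by
    simpa only [sq] using hm.integrable_mul hm
  have s2 : Integrable (fun x => (Laplacian.laplacian z x) ^ 2) := by
    simpa only [sq] using hz.laplacian.integrable_mul hz.laplacian
  -- factor the difference of squares; the first factor is `-(4 x·∇w + 2 N w)`
  calc _ = -∫ x, ((4 * (‖x‖ ^ 2 * Laplacian.laplacian w x * euler w x) +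
        4 * (euler w x * Laplacian.laplacian z x)) +
        (2 * N * (w x * (‖x‖ ^ 2 * Laplacian.laplacian w x)) +
        2 * N * (w x * Laplacian.laplacian z x))) := by
        rw [← integral_sub s1 s2, ← integral_neg]
        congr 1
        ext x
        rw [hz_def, laplacian_norm_sq_mul hw]
        ring
    _ = 0 := by
        rw [integral_add (by exact i1.add i2) (by exact i3.add i4), integral_add i1 i2, integral_add i3 i4,
          integral_const_mul, integral_const_mul, integral_const_mul, integral_const_mul, h1, h2]
        ring

/-! ### Invariance for `q = 2` and `q = 2^*` -/

theorem integral_abs_rpow_eq_iff_eLpNorm_eq {r : ℝ} (hr : 0 < r) {f g : RN N → ℝ}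
    (hf : MemLp f (ENNReal.ofReal r) volume) (hg : MemLp g (ENNReal.ofReal r) volume) :
    ∫ x, |f x| ^ r = ∫ x, |g x| ^ r ↔
      eLpNorm f (ENNReal.ofReal r) volume = eLpNorm g (ENNReal.ofReal r) volume := by
  have hr0 : ENNReal.ofReal r ≠ 0 := by simpa using hr
  have hn (f : RN N → ℝ) : 0 ≤ ∫ x, |f x| ^ r :=
    integral_nonneg fun x => Real.rpow_nonneg (abs_nonneg _) _
  rw [hf.eLpNorm_eq_integral_rpow_norm hr0 (by simp),
    hg.eLpNorm_eq_integral_rpow_norm hr0 (by simp), ENNReal.toReal_ofReal hr.le]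
  simp_rw [Real.norm_eq_abs]
  rw [ENNReal.ofReal_eq_ofReal_iff (Real.rpow_nonneg (hn f) _) (Real.rpow_nonneg (hn g) _),
    Real.rpow_left_inj (hn f) (hn g) (inv_pos.2 hr).ne']

/-- The case `q = 2^*`: the conformal pullback is the Kelvin transform. -/
theorem eLpNorm_laplacian_conformalPullback_kelvin (hN : 0 < N) {p r : ℝ} (hr : 0 < r)
    (hpN : 2 * N / p = (N : ℝ) - 2) (hrN : 2 * N / r = (N : ℝ) + 2)
    {φ : RN N → ℝ} (hφ : IsTestFunction φ) :
    eLpNorm (Laplacian.laplacian (conformalPullback p (unitInversion N) φ))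
      (ENNReal.ofReal r) volume = eLpNorm (Laplacian.laplacian φ) (ENNReal.ofReal r) volume := by
  rw [← eLpNorm_conformalPullback hN hr (Laplacian.laplacian φ)]
  refine eLpNorm_congr_ae ?_
  filter_upwards [ae_ne_zero hN] with x hx
  have h : conformalPullback p (unitInversion N) φ =ᶠ[𝓝 x]
      fun y => ‖y‖ ^ (2 - N : ℝ) * φ (unitInversion N y) := by
    filter_upwards [isOpen_ne.mem_nhds hx] with y hy
    rw [conformalPullback_unitInversion p φ hy, hpN, neg_sub]
  rw [h.laplacian_eq, laplacian_kelvin hx (hφ.contDiffAt_two _),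
    conformalPullback_unitInversion _ _ hx, hrN, neg_add']

/-- The case `q = 2`: the conformal pullback of `φ` is the Kelvin transform of `φ / |x|²`. -/
theorem eLpNorm_laplacian_conformalPullback_two (hN : 0 < N) {p : ℝ}
    (hpN : 2 * N / p = (N : ℝ) - 4) {φ : RN N → ℝ} (hφ : IsTestFunction φ) (h0 : φ =ᶠ[𝓝 0] 0) :
    eLpNorm (Laplacian.laplacian (conformalPullback p (unitInversion N) φ))
      (ENNReal.ofReal 2) volume = eLpNorm (Laplacian.laplacian φ) (ENNReal.ofReal 2) volume := by
  set w : RN N → ℝ := fun x => (‖x‖ ^ 2)⁻¹ * φ x with hw_def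
  have hw : IsTestFunction w := by
    refine ⟨contDiff_iff_contDiffAt.2 fun x => ?_, hφ.2.mul_left⟩
    rcases eq_or_ne x 0 with rfl | hx
    · refine (contDiffAt_const (c := (0 : ℝ))).congr_of_eventuallyEq ?_
      filter_upwards [h0] with y hy
      simp [hw_def, hy]
    · exact ((contDiff_norm_sq ℝ).contDiffAt.inv (by simpa using hx)).mul hφ.1.contDiffAt
  have hφw : φ = fun x => ‖x‖ ^ 2 * w x := by
    ext x
    rcases eq_or_ne x 0 with rfl | hx
    · simpa using h0.eq_of_nhds
    · have : ‖x‖ ≠ 0 := norm_ne_zero_iff.2 hx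
      simp only [hw_def]
      field_simp
  have hm : IsTestFunction (fun x => ‖x‖ ^ 2 * Laplacian.laplacian w x) :=
    hw.laplacian.smooth_mul (contDiff_norm_sq ℝ)
  have h1 : eLpNorm (Laplacian.laplacian φ) (ENNReal.ofReal 2) volume =
      eLpNorm (fun x => ‖x‖ ^ 2 * Laplacian.laplacian w x) (ENNReal.ofReal 2) volume := by
    refine (integral_abs_rpow_eq_iff_eLpNorm_eq two_pos (hφ.laplacian.memLp _) (hm.memLp _)).1 ?_
    simp_rw [Real.rpow_two, sq_abs]
    rw [integral_sq_norm_sq_mul_laplacian hw, ← hφw]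
  rw [h1, ← eLpNorm_conformalPullback hN two_pos (fun x => ‖x‖ ^ 2 * Laplacian.laplacian w x)]
  refine eLpNorm_congr_ae ?_
  filter_upwards [ae_ne_zero hN] with x hx
  have hpow {y : RN N} (hy : y ≠ 0) (c : ℝ) :
      ‖y‖ ^ c * ‖unitInversion N y‖ ^ 2 = ‖y‖ ^ (c - 2) := by
    rw [norm_unitInversion, Real.rpow_sub (norm_pos_iff.2 hy), Real.rpow_two]
    simp [div_eq_mul_inv]
  have h : conformalPullback p (unitInversion N) φ =ᶠ[𝓝 x]
      fun y => ‖y‖ ^ (2 - N : ℝ) * w (unitInversion N y) := by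
    filter_upwards [isOpen_ne.mem_nhds hx] with y hy
    rw [conformalPullback_unitInversion p φ hy, hpN, hφw]
    simp only
    rw [← mul_assoc, hpow hy]
    ring_nf
  rw [h.laplacian_eq, laplacian_kelvin hx (hw.contDiffAt_two _),
    conformalPullback_unitInversion _ _ hx, ← mul_assoc, hpow hx]
  congr 2
  ring

/-! ### Failure of invariance for all other exponents -/

/-- The difference of the two sides of Clarkson's inequality for real numbers `a`, `b` and the exponent
`r`. It is zero for `r = 2`, by the parallelogram identity. -/
noncomputable def clarksonDefect (r a b : ℝ) : ℝ :=
  |a + b| ^ r + |a - b| ^ r - 2 * |a| ^ r - 2 * |b| ^ r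

theorem abs_rpow_eq_sq_rpow (r a : ℝ) : |a| ^ r = (a ^ 2) ^ (r / 2) := by
  rw [← sq_abs, ← Real.rpow_two, ← Real.rpow_mul (abs_nonneg _)]
  congr 1
  ring

theorem clarksonDefect_nonneg {r : ℝ} (hr : 2 ≤ r) (a b : ℝ) : 0 ≤ clarksonDefect r a b := by
  simp only [clarksonDefect, abs_rpow_eq_sq_rpow r]
  have hk : 1 ≤ r / 2 := by linarith
  have h1 := (convexOn_rpow hk).2 (sq_nonneg (a + b)) (sq_nonneg (a - b))
    (by norm_num : (0 : ℝ) ≤ 1 / 2) (by norm_num : (0 : ℝ) ≤ 1 / 2) (by norm_num)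
  have h2 := Real.add_rpow_le_rpow_add (sq_nonneg a) (sq_nonneg b) hk
  have h3 : (1 / 2 : ℝ) • (a + b) ^ 2 + (1 / 2 : ℝ) • (a - b) ^ 2 = a ^ 2 + b ^ 2 := by
    simp only [smul_eq_mul]; ring
  rw [h3] at h1
  simp only [smul_eq_mul] at h1
  linarith

theorem clarksonDefect_nonpos {r : ℝ} (hr0 : 0 ≤ r) (hr : r ≤ 2) (a b : ℝ) :
    clarksonDefect r a b ≤ 0 := by
  simp only [clarksonDefect, abs_rpow_eq_sq_rpow r]
  have hk0 : 0 ≤ r / 2 := by linarith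
  have hk : r / 2 ≤ 1 := by linarith
  have h1 := (Real.concaveOn_rpow hk0 hk).2 (sq_nonneg (a + b)) (sq_nonneg (a - b))
    (by norm_num : (0 : ℝ) ≤ 1 / 2) (by norm_num : (0 : ℝ) ≤ 1 / 2) (by norm_num)
  have h2 := Real.rpow_add_le_add_rpow (sq_nonneg a) (sq_nonneg b) hk0 hk
  have h3 : (1 / 2 : ℝ) • (a + b) ^ 2 + (1 / 2 : ℝ) • (a - b) ^ 2 = a ^ 2 + b ^ 2 := by
    simp only [smul_eq_mul]; ring
  rw [h3] at h1
  simp only [smul_eq_mul] at h1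
  linarith

theorem clarksonDefect_self_ne_zero {r c : ℝ} (hr0 : 0 < r) (hr : r ≠ 2) (hc : c ≠ 0) :
    clarksonDefect r c c ≠ 0 := by
  have h : clarksonDefect r c c = (2 ^ r - 2 ^ (2 : ℝ)) * |c| ^ r := by
    rw [clarksonDefect, ← two_mul, abs_mul, abs_two, Real.mul_rpow two_pos.le (abs_nonneg c),
      sub_self, abs_zero, Real.zero_rpow hr0.ne']
    norm_num
    ring
  rw [h]
  refine mul_ne_zero (sub_ne_zero.2 fun h => hr ?_) (Real.rpow_pos_of_pos (abs_pos.2 hc) r).ne'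
  exact (Real.rpow_right_inj two_pos (by norm_num)).1 h

theorem IsTestFunction.integrable_abs_rpow {φ : RN N → ℝ} (hφ : IsTestFunction φ) {r : ℝ}
    (hr : 0 < r) : Integrable (fun x => |φ x| ^ r) := by
  refine Continuous.integrable_of_hasCompactSupport ?_ ?_
  · exact hφ.1.continuous.abs.rpow_const fun _ => Or.inr hr.le
  · exact hφ.2.comp_left (g := fun t : ℝ => |t| ^ r) (by simp [Real.zero_rpow hr.ne'])

theorem integral_clarksonDefect {r : ℝ} (hr : 0 < r) {φ ψ : RN N → ℝ} (hφ : IsTestFunction φ)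
    (hψ : IsTestFunction ψ) :
    Integrable (fun x => clarksonDefect r (φ x) (ψ x)) ∧
    ∫ x, clarksonDefect r (φ x) (ψ x) = (∫ x, |φ x + ψ x| ^ r) + (∫ x, |φ x - ψ x| ^ r) -
      2 * (∫ x, |φ x| ^ r) - 2 * ∫ x, |ψ x| ^ r := by
  have i1 := (hφ.add hψ).integrable_abs_rpow hr
  have i2 := (hφ.sub hψ).integrable_abs_rpow hr
  have i3 := (hφ.integrable_abs_rpow hr).const_mul 2
  have i4 := (hψ.integrable_abs_rpow hr).const_mul 2
  refine ⟨((i1.add i2).sub i3).sub i4, ?_⟩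
  unfold clarksonDefect
  rw [integral_sub (by exact (i1.add i2).sub i3) i4, integral_sub (by exact i1.add i2) i3, integral_add i1 i2,
    integral_const_mul, integral_const_mul]

theorem continuous_clarksonDefect {r : ℝ} (hr : 0 < r) {φ ψ : RN N → ℝ} (hφ : Continuous φ)
    (hψ : Continuous ψ) : Continuous (fun x => clarksonDefect r (φ x) (ψ x)) := by
  have h {f : RN N → ℝ} (hf : Continuous f) : Continuous fun x => |f x| ^ r :=
    hf.abs.rpow_const fun _ => Or.inr hr.le
  exact (((h (hφ.add hψ)).add (h (hφ.sub hψ))).sub (continuous_const.mul (h hφ))).sub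
    (continuous_const.mul (h hψ))

/-- As the defect has a fixed sign, it vanishes pointwise as soon as its integral does. -/
theorem clarksonDefect_eq_zero_of_integral_eq_zero {r : ℝ} (hr : 0 < r) {φ ψ : RN N → ℝ}
    (hφ : IsTestFunction φ) (hψ : IsTestFunction ψ)
    (h : ∫ x, clarksonDefect r (φ x) (ψ x) = 0) (x : RN N) :
    clarksonDefect r (φ x) (ψ x) = 0 := by
  have hc := continuous_clarksonDefect hr hφ.1.continuous hψ.1.continuous
  have hi := (integral_clarksonDefect hr hφ hψ).1
  rcases le_total 2 r with h2 | h2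
  · have := (integral_eq_zero_iff_of_nonneg (fun x => clarksonDefect_nonneg h2 _ _) hi).1 h
    exact congrFun ((hc.ae_eq_iff_eq volume continuous_const).1 this) x
  · have := (integral_eq_zero_iff_of_nonneg
      (fun x => neg_nonneg.2 (clarksonDefect_nonpos hr.le h2 _ _)) hi.neg).1
      (by simpa [integral_neg] using h)
    exact neg_eq_zero.1 (congrFun ((hc.neg.ae_eq_iff_eq volume continuous_const).1 this) x)

/-- Near a point of the unit sphere at which `φ` is locally equal to `1`, the conformal pullback is
the function `|x|^{-2N/p}`. -/
theorem laplacian_conformalPullback_of_eventually_one {p : ℝ} {φ : RN N → ℝ} {e : RN N}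
    (he : ‖e‖ = 1) (hφ : φ =ᶠ[𝓝 e] fun _ => 1) :
    Laplacian.laplacian (conformalPullback p (unitInversion N) φ) e =
      -(2 * N / p) * (-(2 * N / p) + N - 2) := by
  have he0 : e ≠ 0 := norm_ne_zero_iff.1 (by rw [he]; exact one_ne_zero)
  have hfix : unitInversion N e = e := by simp [unitInversion_eq, he]
  have hc : Tendsto (unitInversion N) (𝓝 e) (𝓝 e) := by
    have := (contDiffAt_unitInversion (n := 1) he0).continuousAt.tendsto
    rwa [hfix] at this
  have h : conformalPullback p (unitInversion N) φ =ᶠ[𝓝 e]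
      fun y => ‖y‖ ^ (-(2 * (N : ℝ) / p)) := by
    filter_upwards [isOpen_ne.mem_nhds he0, hc.eventually hφ] with y hy hy'
    rw [conformalPullback_unitInversion p φ hy, hy', mul_one]
  rw [h.laplacian_eq, laplacian_norm_rpow _ he0, he, Real.one_rpow, mul_one]

/-- If `r ≠ 2` and the pullback is not the Kelvin transform, it does not preserve `‖Δ·‖_r`. The
proof compares two bump functions `u`, `h` at a point `e` of the unit sphere, with `u = 1` on the
support of `h`. Then `Δu` and `Δh` have disjoint supports, so the integral of their Clarkson defect
is zero. If the norm were preserved, the same would hold for the pullbacks, whose Laplacians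
would then have zero Clarkson defect everywhere; but at `e` they have the same nonzero value. -/
theorem exists_eLpNorm_laplacian_conformalPullback_ne (hN : 0 < N) {p r : ℝ} (hp : 0 < p)
    (hr : 0 < r) (hr2 : r ≠ 2) (hpN : 2 * N / p ≠ (N : ℝ) - 2) :
    ∃ φ : RN N → ℝ, IsTestFunction φ ∧ φ =ᶠ[𝓝 0] 0 ∧
      eLpNorm (Laplacian.laplacian (conformalPullback p (unitInversion N) φ))
        (ENNReal.ofReal r) volume ≠ eLpNorm (Laplacian.laplacian φ) (ENNReal.ofReal r) volume := by
  by_contra! hiso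
  set T := conformalPullback p (unitInversion N) with hT
  have hint {φ : RN N → ℝ} (hφ : IsTestFunction φ) (h0 : φ =ᶠ[𝓝 0] 0) :
      ∫ x, |Laplacian.laplacian (T φ) x| ^ r = ∫ x, |Laplacian.laplacian φ x| ^ r :=
    (integral_abs_rpow_eq_iff_eLpNorm_eq hr
      ((isTestFunction_conformalPullback p hφ h0).1.laplacian.memLp _)
      (hφ.laplacian.memLp _)).2 (hiso φ hφ h0)
  obtain ⟨e, he⟩ : ∃ e : RN N, ‖e‖ = 1 := ⟨EuclideanSpace.single ⟨0, hN⟩ 1, by simp⟩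
  let u : ContDiffBump e := ⟨1 / 4, 1 / 2, by norm_num, by norm_num⟩
  let h : ContDiffBump e := ⟨1 / 16, 1 / 8, by norm_num, by norm_num⟩
  have hu : IsTestFunction u := ⟨u.contDiff, u.hasCompactSupport⟩
  have hh : IsTestFunction h := ⟨h.contDiff, h.hasCompactSupport⟩
  have hvan (b : ContDiffBump e) (hb : b.rOut < 1) : (b : RN N → ℝ) =ᶠ[𝓝 0] 0 := by
    have ho : IsOpen {y : RN N | b.rOut < dist y e} :=
      isOpen_lt continuous_const (continuous_id.dist continuous_const)
    filter_upwards [ho.mem_nhds (by simpa [he] using hb)] with y hy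
    exact b.zero_of_le_dist (le_of_lt hy)
  have hu0 := hvan u (by norm_num [u])
  have hh0 := hvan h (by norm_num [h])
  have hTu : IsTestFunction (T u) := (isTestFunction_conformalPullback p hu hu0).1
  have hTh : IsTestFunction (T h) := (isTestFunction_conformalPullback p hh hh0).1
  -- the Laplacians of the two bumps have disjoint supports
  have hdis (x : RN N) : clarksonDefect r (Laplacian.laplacian (u : RN N → ℝ) x)
      (Laplacian.laplacian (h : RN N → ℝ) x) = 0 := by
    rcases lt_or_ge (dist x e) (1 / 4) with hx | hx
    · have h1 : (u : RN N → ℝ) =ᶠ[𝓝 x] fun _ => 1 := by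
        filter_upwards [Metric.isOpen_ball.mem_nhds hx] with y hy
        exact u.one_of_mem_closedBall (Metric.ball_subset_closedBall hy)
      rw [laplacian_eq_zero_of_eventuallyEq h1]
      simp [clarksonDefect, Real.zero_rpow hr.ne']
      ring
    · have ho : IsOpen {y : RN N | 1 / 8 < dist y e} :=
        isOpen_lt continuous_const (continuous_id.dist continuous_const)
      have h1 : (h : RN N → ℝ) =ᶠ[𝓝 x] fun _ => 0 := by
        filter_upwards [ho.mem_nhds (show 1 / 8 < dist x e by linarith)] with y hy
        exact h.zero_of_le_dist (le_of_lt hy)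
      rw [laplacian_eq_zero_of_eventuallyEq h1]
      simp [clarksonDefect, Real.zero_rpow hr.ne']
      ring
  have hadd := hint (hu.add hh) (by filter_upwards [hu0, hh0] with x h1 h2; simp [h1, h2])
  have hsub := hint (hu.sub hh) (by filter_upwards [hu0, hh0] with x h1 h2; simp [h1, h2])
  have hTadd : T (fun x => u x + h x) = fun x => T u x + T h x :=
    funext fun x => conformalPullback_add p _ _ _ x
  have hTsub : T (fun x => u x - h x) = fun x => T u x - T h x :=
    funext fun x => conformalPullback_sub p _ _ _ x
  rw [hTadd] at hadd
  rw [hTsub] at hsub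
  simp_rw [hTu.laplacian_add hTh, hu.laplacian_add hh] at hadd
  simp_rw [hTu.laplacian_sub hTh, hu.laplacian_sub hh] at hsub
  have hzero : ∫ x, clarksonDefect r (Laplacian.laplacian (T u) x)
      (Laplacian.laplacian (T h) x) = 0 := by
    rw [(integral_clarksonDefect hr hTu.laplacian hTh.laplacian).2, hadd, hsub, hint hu hu0,
      hint hh hh0, ← (integral_clarksonDefect hr hu.laplacian hh.laplacian).2]
    simp [hdis]
  have hpt := clarksonDefect_eq_zero_of_integral_eq_zero hr hTu.laplacian hTh.laplacian hzero e
  rw [laplacian_conformalPullback_of_eventually_one he u.eventuallyEq_one,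
    laplacian_conformalPullback_of_eventually_one he h.eventuallyEq_one] at hpt
  have hN' : (0 : ℝ) < N := by exact_mod_cast hN
  refine clarksonDefect_self_ne_zero hr hr2 (mul_ne_zero ?_ fun h => hpN ?_) hpt
  · exact neg_ne_zero.2 (by positivity)
  · linarith

/-! ### The energy functional -/

/-- As the pullback preserves the `L^p` norm, it changes `J` exactly if it changes `‖Δ·‖_r`. -/
theorem energyJ_conformalPullback_eq_iff (hN : 0 < N) {p r : ℝ} (hp : 0 < p) (hr : 0 < r)
    {u : RN N → ℝ} (hu : u ∈ D2 N p r) (hTu : conformalPullback p (unitInversion N) u ∈ D2 N p r) :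
    energyJ p r (conformalPullback p (unitInversion N) u) = energyJ p r u ↔
      lapNorm r (conformalPullback p (unitInversion N) u) = lapNorm r u := by
  have hfin {v : RN N → ℝ} (hv : v ∈ D2 N p r) : lapNorm r v ≠ ⊤ := by
    obtain ⟨-, g, hg, hgr, -⟩ := hv
    rw [hg.lapNorm_eq]
    exact hgr.2.ne
  have hLp := (integral_abs_rpow_eq_iff_eLpNorm_eq hp hTu.1 hu.1).2
    (eLpNorm_conformalPullback hN hp u)
  rw [energyJ, energyJ, hLp, sub_left_inj, mul_right_inj' (by positivity),
    Real.rpow_left_inj ENNReal.toReal_nonneg ENNReal.toReal_nonneg hr.ne',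
    ENNReal.toReal_eq_toReal_iff' (hfin hTu) (hfin hu)]

theorem proposition4p4 (N : ℕ) (hN : 3 ≤ N) (p q : ℝ) (hp : 0 < p) (hq : 0 < q)
    (hpq : 1 / p + 1 / q = ((N : ℝ) - 2) / N) :
    -- the explicit form of `u_ι`
    (∀ (u : RN N → ℝ) (x : RN N), x ≠ 0 →
      conformalPullback p (unitInversion N) u x =
        ‖x‖ ^ (-(2 * (N : ℝ) / p)) * u ((‖x‖ ^ 2)⁻¹ • x)) ∧
    -- the equivalence
    ((∀ u ∈ D2 N p (q / (q - 1)),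
        lapNorm (q / (q - 1)) (conformalPullback p (unitInversion N) u) =
          lapNorm (q / (q - 1)) u) ↔
      (q = 2 ∨ q = 2 * (N : ℝ) / ((N : ℝ) - 2))) ∧
    -- for these values of `q` the transform maps the space into itself
    ((q = 2 ∨ q = 2 * (N : ℝ) / ((N : ℝ) - 2)) →
      ∀ u ∈ D2 N p (q / (q - 1)),
        conformalPullback p (unitInversion N) u ∈ D2 N p (q / (q - 1))) ∧
    -- for all other values of `q` the functional is not invariant under the inversion
    (¬ (q = 2 ∨ q = 2 * (N : ℝ) / ((N : ℝ) - 2)) →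
      ∃ u ∈ D2 N p (q / (q - 1)),
        conformalPullback p (unitInversion N) u ∈ D2 N p (q / (q - 1)) ∧
        energyJ p (q / (q - 1)) (conformalPullback p (unitInversion N) u) ≠
          energyJ p (q / (q - 1)) u) := by
  have hN0 : 0 < N := by lia
  have hN3 : (3 : ℝ) ≤ N := by exact_mod_cast hN
  have hNpos : (0 : ℝ) < N := by linarith
  have hrhs : ((N : ℝ) - 2) / N = 1 - 2 / N := by field_simp
  rw [hrhs] at hpq
  have hip : 0 < 1 / p := by positivity
  have hiq : 0 < 1 / q := by positivity
  have hiN : 0 < 2 / (N : ℝ) := by positivity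
  have hp1 : 1 ≤ p := by
    by_contra! h
    have := one_lt_one_div hp h
    linarith
  have hq1 : 1 < q := by
    by_contra! h
    have := one_le_one_div hq h
    linarith
  set r := q / (q - 1) with hr_def
  have hr0 : 0 < r := div_pos hq (by linarith)
  have hr1 : 1 ≤ r := by
    rw [hr_def, one_le_div (by linarith)]
    linarith
  have hir : 1 / r = 1 - 1 / q := by
    rw [hr_def]
    have : q - 1 ≠ 0 := by linarith
    field_simp
  have hNr : N / r = 2 + N / p := by
    have h1 : (N : ℝ) / r = N * (1 / r) := by ring
    have h2 : 1 / r = 2 / N + 1 / p := by linarith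
    rw [h1, h2]
    field_simp
  have hrN : 2 < N / r := by
    have : 0 < (N : ℝ) / p := by positivity
    linarith
  have hpval : 2 * N / p = 2 * (N : ℝ) - 4 - 2 * N / q := by
    have h1 : (2 * N / p : ℝ) = 2 * N * (1 / p) := by ring
    have h2 : 1 / p = 1 - 2 / N - 1 / q := by linarith
    rw [h1, h2]
    field_simp
    ring
  -- `q = 2^*` holds exactly if the pullback is the Kelvin transform
  have hcrit : q = 2 * (N : ℝ) / (N - 2) ↔ 2 * N / p = (N : ℝ) - 2 := by
    have hN2 : (0 : ℝ) < N - 2 := by linarith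
    rw [hpval, eq_div_iff hN2.ne']
    constructor
    · intro h
      have : 2 * (N : ℝ) / q = N - 2 := by
        rw [div_eq_iff hq.ne']
        linarith
      linarith
    · intro h
      have : 2 * (N : ℝ) / q = N - 2 := by linarith
      rw [div_eq_iff hq.ne'] at this
      linarith
  have hgood (h : q = 2 ∨ q = 2 * (N : ℝ) / ((N : ℝ) - 2)) (u : RN N → ℝ) (hu : u ∈ D2 N p r) :
      conformalPullback p (unitInversion N) u ∈ D2 N p r ∧
        lapNorm r (conformalPullback p (unitInversion N) u) = lapNorm r u := by
    refine conformalPullback_mem_D2 hN0 hp1 hr1 hrN (fun φ hφ h0 => ?_) hu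
    rcases h with h | h
    · have hr2 : r = 2 := by rw [hr_def, h]; norm_num
      rw [hr2]
      refine eLpNorm_laplacian_conformalPullback_two hN0 ?_ hφ h0
      rw [hpval, h]
      ring
    · have hpN := hcrit.1 h
      refine eLpNorm_laplacian_conformalPullback_kelvin hN0 hr0 hpN ?_ hφ
      have h1 : 2 * (N : ℝ) / r = 2 * (N / r) := by ring
      have h2 : 2 * (N : ℝ) / p = 2 * (N / p) := by ring
      rw [h1, hNr]
      linarith
  have hbad (h : ¬ (q = 2 ∨ q = 2 * (N : ℝ) / ((N : ℝ) - 2))) :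
      ∃ u ∈ D2 N p r, conformalPullback p (unitInversion N) u ∈ D2 N p r ∧
        lapNorm r (conformalPullback p (unitInversion N) u) ≠ lapNorm r u := by
    rw [not_or] at h
    have hr2 : r ≠ 2 := by
      intro h2
      rw [hr_def, div_eq_iff (by linarith)] at h2
      exact h.1 (by linarith)
    obtain ⟨φ, hφ, hφ0, hne⟩ := exists_eLpNorm_laplacian_conformalPullback_ne hN0 hp hr0 hr2
      fun hpN => h.2 (hcrit.2 hpN)
    have hTφ := (isTestFunction_conformalPullback p hφ hφ0).1
    refine ⟨φ, hφ.mem_D2 p r, hTφ.mem_D2 p r, ?_⟩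
    rwa [hTφ.isWeakLaplacian.lapNorm_eq, hφ.isWeakLaplacian.lapNorm_eq]
  refine ⟨fun u x hx => ?_, ⟨fun h => ?_, fun h u hu => (hgood h u hu).2⟩,
    fun h u hu => (hgood h u hu).1, fun h => ?_⟩
  · rw [conformalPullback_unitInversion p u hx, unitInversion_eq]
  · by_contra hne
    obtain ⟨u, hu, -, huT⟩ := hbad hne
    exact huT (h u hu)
  · obtain ⟨u, hu, hTu, hne⟩ := hbad h
    exact ⟨u, hu, hTu, fun hJ =>
      hne ((energyJ_conformalPullback_eq_iff hN0 hp hr0 hu hTu).1 hJ)⟩
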